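/- Consider $L\ge 1$ local nodes and a fusion centre. Under hypothesis $H_i$ ($i\in\{0,1\}$, with probability measure $P_i$ and expectation $E_i$), node $l$ observes real random variables $X_{1,l},X_{2,l},\dots$, i.i.d. with density $f_{i,l}$ with respect to a $\sigma$-finite measure $\nu_l$; the fusion-centre noise $Z_1,Z_2,\dots$ is i.i.d. with Lebesgue density $g$ under both hypotheses; all observations and all noise variables are independent. For every $l$ the divergences $D(f_{0,l}\|f_{1,l})$ and $D(f_{1,l}\|f_{0,l})$ are finite and the two distributions are different. Put $D_{tot}^0=\sum_l D(f_{0,l}\|f_{1,l})$, $D_{tot}^1=\sum_l D(f_{1,l}\|f_{0,l})$, $r_l=D(f_{0,l}\|f_{1,l})/D_{tot}^0$ and $\rho_l=D(f_{1,l}\|f_{0,l})/D_{tot}^1$. Fix $b_0,b_1\in\mathbb R$ and $\mu_0,\mu_1>0$, and let $c>0$. In the DualSPRT, node $l$ computes $W_{k,l}=\sum_{j=1}^k\log\frac{f_{1,l}(X_{j,l})}{f_{0,l}(X_{j,l})}$ and transmits, at each time $k\ge 1$, $$Y_{k,l}=b_1\,\mathbb 1\{W_{k,l}\ge \rho_l|\log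 c|\}+b_0\,\mathbb 1\{W_{k,l}\le -r_l|\log c|\}.$$ The fusion centre receives $Y_k=\sum_{l=1}^L Y_{k,l}+Z_k$, computes $F_k=\sum_{j=1}^k\varphi(Y_j)$ (with $F_0=0$), where $\varphi(y)=\log\frac{g(y-\mu_1)}{g(y+\mu_0)}$, and stops at $N=\inf\{k: F_k\ge|\log c|\text{ or }F_k\le-|\log c|\}$. Let $\xi_1^*=\varphi(Lb_{1-i}+Z_1)$ under $H_i$ (the fusion increment when all nodes transmit the wrong decision), $\theta_i=E_i[\xi_1^*]$, and $\Delta(\mathcal A^i)=E_i[\varphi(Lb_i+Z_1)]$ (the mean fusion increment when all nodes transmit the correct decision). Assume that $\theta_i$ is the worst value of the mean of the fusion increment, that is, for all $y_1,\dots,y_L\in\{0,b_0,b_1\}$ the variable $\varphi(\sum_l y_l+Z_1)$ is integrable and $$\theta_1\le E_1\Big[\varphi\Big(\sum_l y_l+Z_1\Big)\Big],\qquad E_0\Big[\varphi\Big(\sum_l y_l+Z_1\Big)\Big]\le\theta_0,$$ and that $\theta_0>0>\theta_1$. Suppose that, for some $\alpha>1$, $E_i\big[|\xi_1^*|^{\alpha+1}\big]<\infty$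 and $E_i\Big[\Big|\log\frac{f_{1,l}(X_{1,l})}{f_{0,l}(X_{1,l})}\Big|^{\alpha+1}\Big]<\infty$ for $i=0,1$ and all $l$. Then, for $i=0,1$, under $H_i$, $$\limsup_{c\to0^+}\frac{N}{|\log c|}\le\frac1{D_{tot}^i}+M_i\quad\text{almost surely and in }L^1,$$ where $M_i=C_i/\Delta(\mathcal A^i)$, $C_0=-\Big[1+\frac{E_0|\xi_1^*|}{D_{tot}^0}\Big]$ and $C_1=1+\frac{E_1|\xi_1^*|}{D_{tot}^1}$. Here "in $L^1$" means that $E_i\Big[\Big(\frac{N}{|\log c|}-\frac1{D_{tot}^i}-M_i\Big)^+\Big]\to0$ as $c\to0^+$; in particular $\limsup_{c\to0^+}\frac{E_i[N]}{|\log c|}\le\frac1{D_{tot}^i}+M_i$. -/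

import Mathlib

open MeasureTheory ProbabilityTheory Filter Topology
open scoped ENNReal

noncomputable section

namespace DualSPRT

/-! Hypotheses `H_0`, `H_1` are indexed by `i : Fin 2`, and `1 - i` is the other hypothesis.
Times are shifted by one for the data: `X k l` and `Z k` (`k = 0, 1, …`) are the observation of
node `l` and the fusion-centre noise at time `k + 1`. -/

/-- The measure with density `f` with respect to `ν`. -/
def law (ν : Measure ℝ) (f : ℝ → ℝ) : Measure ℝ :=
  ν.withDensity fun x => ENNReal.ofReal (f x)

/-- The log-likelihood ratio `log (f₁ / f₀)` used at a local node. -/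
def localLLR (f : Fin 2 → ℝ → ℝ) (x : ℝ) : ℝ :=
  Real.log (f 1 x / f 0 x)

/-- The log-likelihood ratio `log (g_{μ₁} / g_{-μ₀})` used at the fusion centre, where `g` is the
noise density, `g_{μ₁}` is the density of `Z + μ₁` and `g_{-μ₀}` the density of `Z - μ₀`. -/
def fusionLLR (g : ℝ → ℝ) (μ : Fin 2 → ℝ) (y : ℝ) : ℝ :=
  Real.log (g (y - μ 1) / g (y + μ 0))

/-- What a node with lower threshold `-γ₀` and upper threshold `γ₁` transmits when its test
statistic is `w`. -/
def transmit (b : Fin 2 → ℝ) (γ₀ γ₁ w : ℝ) : ℝ :=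
  (if γ₁ ≤ w then b 1 else 0) + (if w ≤ -γ₀ then b 0 else 0)

variable {Ω : Type*} {L : ℕ}

/-- The test statistic `W_{k,l}` of node `l` at time `k`. -/
def localStat (f : Fin 2 → Fin L → ℝ → ℝ) (X : ℕ → Fin L → Ω → ℝ) (k : ℕ) (l : Fin L)
    (ω : Ω) : ℝ :=
  ∑ j ∈ Finset.range k, localLLR (fun i => f i l) (X j l ω)

/-- The signal `Y_{k+1}` received by the fusion centre at time `k + 1`. -/
def received (f : Fin 2 → Fin L → ℝ → ℝ) (γ : Fin 2 → Fin L → ℝ) (b : Fin 2 → ℝ)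
    (X : ℕ → Fin L → Ω → ℝ) (Z : ℕ → Ω → ℝ) (k : ℕ) (ω : Ω) : ℝ :=
  ∑ l, transmit b (γ 0 l) (γ 1 l) (localStat f X (k + 1) l ω) + Z k ω

/-- The test statistic `F_k` of the fusion centre at time `k`. -/
def fusionStat (f : Fin 2 → Fin L → ℝ → ℝ) (γ : Fin 2 → Fin L → ℝ) (b : Fin 2 → ℝ)
    (g : ℝ → ℝ) (μ : Fin 2 → ℝ) (X : ℕ → Fin L → Ω → ℝ) (Z : ℕ → Ω → ℝ) (k : ℕ) (ω : Ω) : ℝ :=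
  ∑ j ∈ Finset.range k, fusionLLR g μ (received f γ b X Z j ω)

/-- The stopping time of DualSPRT with local thresholds `-γ 0 l, γ 1 l` and fusion thresholds
`-β 0, β 1`; it is `⊤` if neither fusion threshold is ever crossed. -/
def stopTime (f : Fin 2 → Fin L → ℝ → ℝ) (γ : Fin 2 → Fin L → ℝ) (β b : Fin 2 → ℝ)
    (g : ℝ → ℝ) (μ : Fin 2 → ℝ) (X : ℕ → Fin L → Ω → ℝ) (Z : ℕ → Ω → ℝ) (ω : Ω) : ℕ∞ :=
  ⨅ (k : ℕ) (_ : β 1 ≤ fusionStat f γ b g μ X Z k ω ∨ fusionStat f γ b g μ X Z k ω ≤ -β 0),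
    (k : ℕ∞)

/-- The divergence `D(f_{i,l} ‖ f_{1-i,l})`. -/
def kl (ν : Fin L → Measure ℝ) (f : Fin 2 → Fin L → ℝ → ℝ) (i : Fin 2) (l : Fin L) : ℝ≥0∞ :=
  InformationTheory.klDiv (law (ν l) (f i l)) (law (ν l) (f (1 - i) l))

/-- `D_tot^i = ∑_l D(f_{i,l} ‖ f_{1-i,l})`. -/
def Dtot (ν : Fin L → Measure ℝ) (f : Fin 2 → Fin L → ℝ → ℝ) (i : Fin 2) : ℝ :=
  ∑ l, (kl ν f i l).toReal

/-- The ratios `r_l` (for `i = 0`) and `ρ_l` (for `i = 1`). -/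
def share (ν : Fin L → Measure ℝ) (f : Fin 2 → Fin L → ℝ → ℝ) (i : Fin 2) (l : Fin L) : ℝ :=
  (kl ν f i l).toReal / Dtot ν f i

/-- The stopping time `N` of DualSPRT with local thresholds `-r_l |log c|, ρ_l |log c|` and
fusion thresholds `-|log c|, |log c|`. -/
def N (ν : Fin L → Measure ℝ) (f : Fin 2 → Fin L → ℝ → ℝ) (b : Fin 2 → ℝ) (g : ℝ → ℝ)
    (μ : Fin 2 → ℝ) (X : ℕ → Fin L → Ω → ℝ) (Z : ℕ → Ω → ℝ) (c : ℝ) (ω : Ω) : ℕ∞ :=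
  stopTime f (fun i l => share ν f i l * |Real.log c|) (fun _ => |Real.log c|) b g μ X Z ω

/-- The fusion increment `ξ_1^*` when every one of the `L` nodes transmits the wrong decision
under `H_i`. -/
def worstIncr (L : ℕ) (b : Fin 2 → ℝ) (g : ℝ → ℝ) (μ : Fin 2 → ℝ) (Z : ℕ → Ω → ℝ) (i : Fin 2)
    (ω : Ω) : ℝ :=
  fusionLLR g μ (L * b (1 - i) + Z 0 ω)

variable [MeasurableSpace Ω]

/-- `θ_i`, the mean of `ξ_1^*` under `H_i`. -/
def theta (L : ℕ) (P : Fin 2 → Measure Ω) (b : Fin 2 → ℝ) (g : ℝ → ℝ) (μ : Fin 2 → ℝ)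
    (Z : ℕ → Ω → ℝ) (i : Fin 2) : ℝ :=
  ∫ ω, worstIncr L b g μ Z i ω ∂(P i)

/-- `Δ(𝒜^i)`, the mean under `H_i` of a fusion increment when every one of the `L` nodes
transmits the correct decision `b_i`. -/
def Delta (L : ℕ) (P : Fin 2 → Measure Ω) (b : Fin 2 → ℝ) (g : ℝ → ℝ) (μ : Fin 2 → ℝ)
    (Z : ℕ → Ω → ℝ) (i : Fin 2) : ℝ :=
  ∫ ω, fusionLLR g μ (L * b i + Z 0 ω) ∂(P i)

/-- The constant `C_i = ∓ [1 + E_i|ξ_1^*| / D_tot^i]` (minus for `i = 0`, plus for `i = 1`). -/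
def C (P : Fin 2 → Measure Ω) (ν : Fin L → Measure ℝ) (f : Fin 2 → Fin L → ℝ → ℝ)
    (b : Fin 2 → ℝ) (g : ℝ → ℝ) (μ : Fin 2 → ℝ) (Z : ℕ → Ω → ℝ) (i : Fin 2) : ℝ :=
  (if i = 0 then -1 else 1) * (1 + (∫ ω, |worstIncr L b g μ Z i ω| ∂(P i)) / Dtot ν f i)

/-- The constant `M_i = C_i / Δ(𝒜^i)`. -/
def M (P : Fin 2 → Measure Ω) (ν : Fin L → Measure ℝ) (f : Fin 2 → Fin L → ℝ → ℝ)
    (b : Fin 2 → ℝ) (g : ℝ → ℝ) (μ : Fin 2 → ℝ) (Z : ℕ → Ω → ℝ) (i : Fin 2) : ℝ :=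
  C P ν f b g μ Z i / Delta L P b g μ Z i

end DualSPRT

end

/-! Put `a = |log c|` and multiply all log-likelihood ratios by `sgn i`, so that under `H_i` every
local walk drifts upwards with slope `d l`, the divergence at node `l`. Its threshold is `d l / D *
a`, so all nodes reach the correct decision at about the same time `a / D`. Before that they are
silent and the fusion increments have mean at least `-q`, with `q = E|ξ*|`; afterwards they have
mean `Δ > 0`. At time `t * a` the fusion statistic is therefore at least about `(-q / D + Δ * (t - 1
/ D)) * a`, which exceeds `a` once `t > 1 / D + (1 + q / D) / Δ`. The strong law makes this rigorous
(`eventually_le_sum_range`); the increments in a window of relative width `ε` around `a / D` are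
controlled only by a bound `V`, and cost `O(ε * a)`.

For `L¹`, `T / a` must be dominated. Pathwise (`le_of_shortfall`), `T` is at most a constant times
`a`, plus twice the sum of `V j` up to the settling time `a * τ`, plus the shortfall of the walk
with increments `B`. Both `τ` and the shortfall are suprema of random walks with negative drift,
integrable because the increments have second moments (`lintegral_iSup_sum_lt_top`). As `V j`
depends on the noise alone, it is independent of `τ`; truncating `V` at `K` then leaves a fixed
integrable majorant and a Wald-type error that is small in `L¹` (`exists_domination`). Dominated
convergence concludes (`tendsto_lintegral_excess`). All this is assembled in
`asymptotic_crossing_time`. -/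

namespace DualSPRT

/-! ### Independence of disjoint subfamilies -/

section Independence

variable {Ω κ : Type*} [MeasurableSpace Ω] {P : Measure Ω}

/-- Disjoint subfamilies of an independent family are independent. -/
lemma indepFun_subfamily {F : κ → Ω → ℝ} (h : iIndepFun F P) (hF : ∀ i, Measurable (F i))
    {α β : Type*} (u : α → κ) (v : β → κ) (huv : ∀ a b, u a ≠ v b) :
    IndepFun (fun ω a => F (u a) ω) (fun ω b => F (v b) ω) P := by
  have key := indep_iSup_of_disjoint (fun i => (hF i).comap_le) h
    (S := Set.range u) (T := Set.range v) (by
      rw [Set.disjoint_left]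
      rintro _ ⟨a, rfl⟩ ⟨b, hb⟩
      exact huv a b hb.symm)
  rw [IndepFun_iff_Indep]
  refine indep_of_indep_of_le_left (indep_of_indep_of_le_right key ?_) ?_
  · exact measurable_iff_comap_le.1 (by
      refine @measurable_pi_lambda _ _ _ (_) _ _ fun a => ?_
      exact measurable_iff_comap_le.2 (le_iSup₂_of_le (v a) ⟨a, rfl⟩ le_rfl))
  · exact measurable_iff_comap_le.1 (by
      refine @measurable_pi_lambda _ _ _ (_) _ _ fun a => ?_
      exact measurable_iff_comap_le.2 (le_iSup₂_of_le (u a) ⟨a, rfl⟩ le_rfl))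

end Independence

/-! ### Maxima of random walks with negative drift -/

/-- The maximum of the partial sums `∑ j < k, x j` over `k ≤ n`. -/
noncomputable def maxPartialSum : ℕ → (ℕ → ℝ) → ℝ
  | 0, _ => 0
  | n + 1, x => max 0 (x 0 + maxPartialSum n fun k => x (k + 1))

lemma maxPartialSum_nonneg (n : ℕ) (x : ℕ → ℝ) : 0 ≤ maxPartialSum n x := by
  cases n <;> simp [maxPartialSum]

lemma maxPartialSum_le_succ (n : ℕ) (x : ℕ → ℝ) :
    maxPartialSum n x ≤ maxPartialSum (n + 1) x := by
  induction n generalizing x with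
  | zero => exact maxPartialSum_nonneg 1 x
  | succ n ih =>
    rw [maxPartialSum, maxPartialSum]
    gcongr
    exact ih _

lemma sum_le_maxPartialSum (n : ℕ) (x : ℕ → ℝ) :
    ∑ j ∈ Finset.range n, x j ≤ maxPartialSum n x := by
  induction n generalizing x with
  | zero => simp [maxPartialSum]
  | succ n ih =>
    rw [maxPartialSum, Finset.sum_range_succ', add_comm]
    exact le_max_of_le_right (by gcongr; exact ih _)

lemma maxPartialSum_le_sum_abs (n : ℕ) (x : ℕ → ℝ) :
    maxPartialSum n x ≤ ∑ j ∈ Finset.range n, |x j| := by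
  induction n generalizing x with
  | zero => simp [maxPartialSum]
  | succ n ih =>
    rw [maxPartialSum, Finset.sum_range_succ', add_comm (x 0)]
    exact max_le (by positivity) (add_le_add (ih _) (le_abs_self _))

lemma measurable_maxPartialSum (n : ℕ) : Measurable (maxPartialSum n) := by
  induction n with
  | zero => exact measurable_const
  | succ n ih =>
    have : Measurable fun x : ℕ → ℝ => fun k => x (k + 1) :=
      measurable_pi_lambda _ fun k => measurable_pi_apply _
    exact measurable_const.max ((measurable_pi_apply 0).add (ih.comp this))

section Moments

variable {Ω : Type*} [MeasurableSpace Ω] {P : Measure Ω}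

lemma memLp_maxPartialSum {X : ℕ → Ω → ℝ} (hX : ∀ k, Measurable (X k))
    (h2 : ∀ k, MemLp (X k) 2 P) (n : ℕ) :
    MemLp (fun ω => maxPartialSum n fun k => X k ω) 2 P := by
  have hs : MemLp (fun ω => ∑ j ∈ Finset.range n, |X j ω|) 2 P :=
    memLp_finsetSum _ fun j _ => (h2 j).abs
  refine hs.mono' ((measurable_maxPartialSum n).comp
    (measurable_pi_lambda _ hX)).aestronglyMeasurable (ae_of_all _ fun ω => ?_)
  rw [Real.norm_of_nonneg (maxPartialSum_nonneg _ _)]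
  exact maxPartialSum_le_sum_abs _ _

/-- The expected maximum of a random walk with negative drift is bounded by its second moment. -/
lemma integral_maxPartialSum_le [IsProbabilityMeasure P] {X : ℕ → Ω → ℝ}
    (hX : ∀ k, Measurable (X k)) (hind : iIndepFun X P)
    (hid : ∀ k, IdentDistrib (X k) (X 0) P P) (h2 : MemLp (X 0) 2 P)
    {m : ℝ} (hm : 0 < m) (hmean : ∫ ω, X 0 ω ∂P = -m) (n : ℕ) :
    ∫ ω, maxPartialSum n (fun k => X k ω) ∂P ≤ (∫ ω, X 0 ω ^ 2 ∂P) / (2 * m) := by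
  have h2' : ∀ k, MemLp (X k) 2 P := fun k => (hid k).memLp_iff.2 h2
  -- The recursion gives `M ≤ max 0 (X 0 + M')` with `M'` independent of `X 0` and distributed as
  -- `M`. Squaring and integrating, `E M² ≤ E X₀² - 2 m E M + E M²`; the second moments of `M`
  -- cancel and leave a bound free of `n`.
  set M : Ω → ℝ := fun ω => maxPartialSum n fun k => X k ω
  set M' : Ω → ℝ := fun ω => maxPartialSum n fun k => X (k + 1) ω
  have mM : MemLp M 2 P := memLp_maxPartialSum hX h2' n
  have mM' : MemLp M' 2 P := memLp_maxPartialSum (fun k => hX _) (fun k => h2' _) n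
  have hind' : iIndepFun (fun k => X (k + 1)) P :=
    hind.precomp (g := fun k : ℕ => k + 1) (fun a b h => by simpa using h)
  have hpi := (IdentDistrib.pi (X := fun k => X (k + 1)) (Y := X)
    (fun k => (hid (k + 1)).trans (hid k).symm) hind' hind)
  have hidM : IdentDistrib M' M P P := hpi.comp (measurable_maxPartialSum n)
  have hindM : IndepFun (X 0) M' P := by
    have := indepFun_subfamily hind hX (fun _ : Unit => 0) (fun k : ℕ => k + 1) (by simp)
    exact this.comp (measurable_pi_apply ()) (measurable_maxPartialSum n)
  have hle : ∫ ω, M ω ^ 2 ∂P ≤ ∫ ω, (X 0 ω + M' ω) ^ 2 ∂P := by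
    refine integral_mono mM.integrable_sq (h2.add mM').integrable_sq fun ω => ?_
    have h0 : 0 ≤ M ω := maxPartialSum_nonneg _ _
    have h1 : M ω ≤ max 0 (X 0 ω + M' ω) := maxPartialSum_le_succ n _
    rcases le_max_iff.1 h1 with h | h
    · have : M ω = 0 := le_antisymm h h0
      rw [this, zero_pow two_ne_zero]
      exact sq_nonneg (X 0 ω + M' ω)
    · exact pow_le_pow_left₀ h0 h 2
  have hexp : ∫ ω, (X 0 ω + M' ω) ^ 2 ∂P
      = ∫ ω, X 0 ω ^ 2 ∂P + 2 * ((-m) * ∫ ω, M ω ∂P) + ∫ ω, M ω ^ 2 ∂P := by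
    have i1 := h2.integrable_sq
    have i2 := mM'.integrable_sq
    have i3 : Integrable (fun ω => X 0 ω * M' ω) P := h2.integrable_mul mM'
    have e : ∀ ω, (X 0 ω + M' ω) ^ 2 = X 0 ω ^ 2 + 2 * (X 0 ω * M' ω) + M' ω ^ 2 :=
      fun ω => by ring
    simp_rw [e]
    have i4 : Integrable (fun ω => X 0 ω ^ 2 + 2 * (X 0 ω * M' ω)) P := i1.add (i3.const_mul 2)
    rw [integral_add i4 i2, integral_add i1 (i3.const_mul 2),
      integral_const_mul, hindM.integral_fun_mul_eq_mul_integral h2.1 mM'.1, hmean,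
      hidM.integral_eq, (hidM.sq).integral_eq]
  rw [le_div_iff₀ (by positivity)]
  nlinarith

/-- The supremum of a random walk with negative drift and square integrable increments is
integrable. -/
lemma lintegral_iSup_sum_lt_top [IsProbabilityMeasure P] {X : ℕ → Ω → ℝ}
    (hX : ∀ k, Measurable (X k)) (hind : iIndepFun X P)
    (hid : ∀ k, IdentDistrib (X k) (X 0) P P) (h2 : MemLp (X 0) 2 P)
    (hmean : ∫ ω, X 0 ω ∂P < 0) :
    ∫⁻ ω, ⨆ k, ENNReal.ofReal (∑ j ∈ Finset.range k, X j ω) ∂P < ⊤ := by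
  set m := -∫ ω, X 0 ω ∂P with hm
  have hmpos : 0 < m := by linarith
  have h2' : ∀ k, MemLp (X k) 2 P := fun k => (hid k).memLp_iff.2 h2
  calc ∫⁻ ω, ⨆ k, ENNReal.ofReal (∑ j ∈ Finset.range k, X j ω) ∂P
      ≤ ∫⁻ ω, ⨆ n, ENNReal.ofReal (maxPartialSum n fun k => X k ω) ∂P := by
        refine lintegral_mono fun ω => iSup_mono fun n => ?_
        exact ENNReal.ofReal_le_ofReal (sum_le_maxPartialSum _ _)
    _ = ⨆ n, ∫⁻ ω, ENNReal.ofReal (maxPartialSum n fun k => X k ω) ∂P := by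
        refine lintegral_iSup (fun n => ?_) ?_
        · exact ((measurable_maxPartialSum n).comp (measurable_pi_lambda _ hX)).ennreal_ofReal
        · exact monotone_nat_of_le_succ fun n ω =>
            ENNReal.ofReal_le_ofReal (maxPartialSum_le_succ _ _)
    _ ≤ ENNReal.ofReal ((∫ ω, X 0 ω ^ 2 ∂P) / (2 * m)) := by
        refine iSup_le fun n => ?_
        rw [← ofReal_integral_eq_lintegral_ofReal
          ((memLp_maxPartialSum hX h2' n).integrable (by norm_num))
          (ae_of_all _ fun ω => maxPartialSum_nonneg _ _)]
        exact ENNReal.ofReal_le_ofReal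
          (integral_maxPartialSum_le hX hind hid h2 hmpos (by rw [hm, neg_neg]) n)
    _ < ⊤ := ENNReal.ofReal_lt_top

end Moments

/-! ### Pathwise consequences of the law of large numbers -/

section Deterministic

/-- Only finitely many terms can be negative. This turns a limit in `k` into a bound uniform in `k`,
whose constant a large threshold absorbs. -/
lemma exists_lower_bound_of_tendsto_div {u : ℕ → ℝ} {d : ℝ} (hd : 0 < d)
    (hu : Tendsto (fun k : ℕ => u k / k) atTop (𝓝 d)) : ∃ C, 0 ≤ C ∧ ∀ k, -C ≤ u k := by
  have h1 : ∀ᶠ k : ℕ in atTop, 0 ≤ u k := by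
    filter_upwards [hu.eventually (lt_mem_nhds hd), eventually_gt_atTop 0] with k hk hk0
    have : (0 : ℝ) < k := by exact_mod_cast hk0
    exact ((div_pos_iff_of_pos_right this).1 hk).le
  obtain ⟨n, hn⟩ := eventually_atTop.1 h1
  refine ⟨∑ j ∈ Finset.range n, |u j|, by positivity, fun k => ?_⟩
  rcases le_or_gt n k with h | h
  · have := hn k h
    have h2 : 0 ≤ ∑ j ∈ Finset.range n, |u j| := by positivity
    linarith
  · have := Finset.single_le_sum (f := fun j => |u j|) (fun j _ => abs_nonneg _)
      (Finset.mem_range.2 h)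
    have h3 := neg_abs_le (u k)
    linarith

/-- Write `u (n a) / a` as `u (n a) / n a` times `n a / a`; `n` will be the floor or ceiling of a
multiple of `a`. -/
lemma tendsto_floor_sum_div {u : ℕ → ℝ} {m c : ℝ} (hc : 0 < c)
    (hu : Tendsto (fun k : ℕ => u k / k) atTop (𝓝 m)) (n : ℝ → ℕ)
    (hn : Tendsto (fun a : ℝ => (n a : ℝ) / a) atTop (𝓝 c)) :
    Tendsto (fun a : ℝ => u (n a) / a) atTop (𝓝 (m * c)) := by
  have hninf : Tendsto n atTop atTop := by
    have h1 : Tendsto (fun a : ℝ => (n a : ℝ) / a * a) atTop atTop :=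
      hn.pos_mul_atTop hc tendsto_id
    have h2 : Tendsto (fun a : ℝ => (n a : ℝ)) atTop atTop := by
      refine h1.congr' ?_
      filter_upwards [eventually_gt_atTop 0] with a ha
      field_simp
    exact tendsto_natCast_atTop_iff.1 h2
  refine ((hu.comp hninf).mul hn).congr' ?_
  filter_upwards [hninf.eventually_gt_atTop 0, eventually_gt_atTop 0] with a h1 h2
  have : (0 : ℝ) < n a := by exact_mod_cast h1
  simp only [Function.comp]
  field_simp

variable {W : ℕ → ℝ} {d : ℝ}

lemma tendsto_affine_div (hW : Tendsto (fun k : ℕ => W k / k) atTop (𝓝 d))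
    (p q : ℝ) :
    Tendsto (fun k : ℕ => (p * k + q * W k) / k) atTop (𝓝 (p + q * d)) := by
  refine (tendsto_const_nhds.add (hW.const_mul q)).congr' ?_
  filter_upwards [eventually_gt_atTop 0] with k hk
  have : (0 : ℝ) < k := by exact_mod_cast hk
  field_simp

lemma eventually_forall_lt_of_le (hd : 0 < d)
    (hW : Tendsto (fun k : ℕ => W k / k) atTop (𝓝 d)) {D ε : ℝ} (hD : 0 < D) (hε : 0 < ε) :
    ∀ᶠ a : ℝ in atTop, ∀ k : ℕ, (k : ℝ) ≤ (1 - ε) / D * a → W k < d / D * a := by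
  -- The walk `(1 + ε) * d * k - W k` has slope `ε * d > 0`. Since `(1 + ε) * (1 - ε) = 1 - ε ^ 2`,
  -- the slack is `ε ^ 2 * d / D * a`, which beats `C` for large `a`.
  obtain ⟨C, hC0, hC⟩ := exists_lower_bound_of_tendsto_div
    (u := fun k => ((1 + ε) * d) * k + (-1) * W k) (d := (1 + ε) * d + (-1) * d)
    (by nlinarith) (tendsto_affine_div hW _ _)
  filter_upwards [eventually_gt_atTop (C / (ε ^ 2 * d / D))] with a ha k hk
  rw [div_lt_iff₀ (by positivity)] at ha
  have h1 := hC k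
  have h2 : (1 + ε) * d * k ≤ (1 + ε) * d * ((1 - ε) / D * a) := by gcongr
  have h3 : (1 + ε) * d * ((1 - ε) / D * a) = d / D * a - a * (ε ^ 2 * d / D) := by
    field_simp; ring
  linarith

lemma eventually_forall_neg_lt (hd : 0 < d)
    (hW : Tendsto (fun k : ℕ => W k / k) atTop (𝓝 d)) {r : ℝ} (hr : 0 < r) :
    ∀ᶠ a : ℝ in atTop, ∀ k : ℕ, -(r * a) < W k := by
  obtain ⟨C, hC0, hC⟩ := exists_lower_bound_of_tendsto_div hd hW
  filter_upwards [eventually_gt_atTop (C / r)] with a ha k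
  rw [div_lt_iff₀ hr] at ha
  have := hC k
  linarith

lemma eventually_forall_le_of_ge (hd : 0 < d)
    (hW : Tendsto (fun k : ℕ => W k / k) atTop (𝓝 d)) {D ε : ℝ} (hD : 0 < D) (hε : 0 < ε)
    (hε1 : ε < 1) :
    ∀ᶠ a : ℝ in atTop, ∀ k : ℕ, (1 + ε) / D * a ≤ k → d / D * a ≤ W k := by
  -- Slope `1 - ε / 2` works because `(1 - ε / 2) * (1 + ε) = 1 + ε / 2 - ε ^ 2 / 2`, which exceeds
  -- `1` for `ε < 1`.
  obtain ⟨C, hC0, hC⟩ := exists_lower_bound_of_tendsto_div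
    (u := fun k => (-((1 - ε / 2) * d)) * k + 1 * W k) (d := -((1 - ε / 2) * d) + 1 * d)
    (by nlinarith) (tendsto_affine_div hW _ _)
  have hpos : 0 < (ε / 2 - ε ^ 2 / 2) * d / D := by
    have : 0 < ε / 2 - ε ^ 2 / 2 := by nlinarith
    positivity
  filter_upwards [eventually_gt_atTop (C / ((ε / 2 - ε ^ 2 / 2) * d / D))] with a ha k hk
  rw [div_lt_iff₀ hpos] at ha
  have h1 := hC k
  have h0 : 0 < 1 - ε / 2 := by linarith
  have h2 : (1 - ε / 2) * d * ((1 + ε) / D * a) ≤ (1 - ε / 2) * d * k := by gcongr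
  have h3 : (1 - ε / 2) * d * ((1 + ε) / D * a)
      = d / D * a + a * ((ε / 2 - ε ^ 2 / 2) * d / D) := by
    field_simp; ring
  linarith

/-- If the local statistics and the fusion increments obey laws of large numbers, then the fusion
statistic has crossed the threshold `a` by time `t * a`, for all large `a`. -/
lemma eventually_le_sum_range {ι : Type*} [Finite ι] {W : ℕ → ι → ℝ} {d r : ι → ℝ} {D : ℝ}
    (hd : ∀ l, 0 < d l) (hr : ∀ l, 0 < r l) (hD : 0 < D)
    (hW : ∀ l, Tendsto (fun k : ℕ => W k l / k) atTop (𝓝 (d l)))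
    {A B V : ℕ → ℝ} {mA Δ v q t : ℝ}
    (hA : Tendsto (fun k : ℕ => (∑ j ∈ Finset.range k, A j) / k) atTop (𝓝 mA))
    (hB : Tendsto (fun k : ℕ => (∑ j ∈ Finset.range k, B j) / k) atTop (𝓝 Δ))
    (hV : Tendsto (fun k : ℕ => (∑ j ∈ Finset.range k, V j) / k) atTop (𝓝 v))
    {I : ℝ → ℕ → ℝ} (hIV : ∀ a > 0, ∀ j, |I a j| ≤ V j)
    (hIB : ∀ a > 0, ∀ j, (∀ l, d l / D * a ≤ W (j + 1) l) → I a j = B j)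
    (hIA : ∀ a > 0, ∀ j, (∀ l, -(r l * a) < W (j + 1) l ∧ W (j + 1) l < d l / D * a) →
      I a j = A j)
    (hΔ : 0 < Δ) (hq : 0 ≤ q) (hmA : -q ≤ mA) (ht : 1 / D + (1 + q / D) / Δ < t) :
    ∀ᶠ a : ℝ in atTop, a ≤ ∑ j ∈ Finset.range ⌊t * a⌋₊, I a j := by
  -- The function of `ε` is the limit of the lower bound on the sum divided by `a`, cut at times `(1
  -- ± ε) / D * a`: silent part, loss `V` in the window, correct part. It is continuous and exceeds
  -- `1` at `ε = 0`, hence also for some small `ε > 0`.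
  have hcont : Tendsto (fun ε : ℝ => mA * ((1 - ε) / D)
      - (v * ((1 + ε) / D) - v * ((1 - ε) / D)) + (Δ * t - Δ * ((1 + ε) / D))) (𝓝[>] 0)
      (𝓝 (mA * ((1 - 0) / D) - (v * ((1 + 0) / D) - v * ((1 - 0) / D))
        + (Δ * t - Δ * ((1 + 0) / D)))) := by
    refine (Continuous.tendsto ?_ 0).mono_left nhdsWithin_le_nhds
    fun_prop
  have hlim : 1 < mA * ((1 - 0) / D) - (v * ((1 + 0) / D) - v * ((1 - 0) / D))
        + (Δ * t - Δ * ((1 + 0) / D)) := by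
    have h1 : Δ * (1 / D + (1 + q / D) / Δ) < Δ * t := by gcongr
    have h2 : Δ * (1 / D + (1 + q / D) / Δ) = Δ * (1 / D) + 1 + q / D := by field_simp; ring
    have h3 : -q * (1 / D) ≤ mA * (1 / D) := by gcongr
    have h4 : q / D = q * (1 / D) := by ring
    simp only [sub_zero, add_zero]
    linarith
  have hDt : 1 / D < t := by
    have : 0 < (1 + q / D) / Δ := by positivity
    linarith
  have hcont2 : Tendsto (fun ε : ℝ => (1 + ε) / D) (𝓝[>] 0) (𝓝 ((1 + 0) / D)) := by
    refine (Continuous.tendsto ?_ 0).mono_left nhdsWithin_le_nhds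
    fun_prop
  obtain ⟨ε, hε, hεt, hε1, hε0⟩ := ((hcont.eventually (lt_mem_nhds hlim)).and
    ((hcont2.eventually (gt_mem_nhds (by simpa using hDt))).and
    (Filter.Eventually.and (nhdsWithin_le_nhds (gt_mem_nhds one_pos))
      self_mem_nhdsWithin))).exists
  have hε0 : 0 < ε := hε0
  have hc1 : 0 < (1 - ε) / D := div_pos (by linarith) hD
  have hc2 : 0 < (1 + ε) / D := div_pos (by linarith) hD
  have hc3 : 0 < t := lt_trans (by positivity) hDt
  have f1 := tendsto_nat_floor_mul_div_atTop hc1.le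
  have f2 := tendsto_nat_ceil_mul_div_atTop hc2.le
  have f3 := tendsto_nat_floor_mul_div_atTop hc3.le
  have T := (((tendsto_floor_sum_div hc1 hA _ f1).sub
    ((tendsto_floor_sum_div hc2 hV _ f2).sub (tendsto_floor_sum_div hc1 hV _ f1))).add
    ((tendsto_floor_sum_div hc3 hB _ f3).sub (tendsto_floor_sum_div hc2 hB _ f2)))
  filter_upwards [T.eventually (lt_mem_nhds hε), eventually_gt_atTop 0,
    (f2.eventually_lt f3 hεt),
    eventually_all.2 fun l => eventually_forall_lt_of_le (hd l) (hW l) hD hε0,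
    eventually_all.2 fun l => eventually_forall_neg_lt (hd l) (hW l) (hr l),
    eventually_all.2 fun l => eventually_forall_le_of_ge (hd l) (hW l) hD hε0 hε1]
    with a hT ha h23 e1 e2 e3
  set n1 := ⌊(1 - ε) / D * a⌋₊
  set n2 := ⌈(1 + ε) / D * a⌉₊
  set k := ⌊t * a⌋₊
  have hn12 : n1 ≤ n2 := by
    have h1 : (n1 : ℝ) ≤ (1 - ε) / D * a := Nat.floor_le (by positivity)
    have h2 : (1 + ε) / D * a ≤ (n2 : ℝ) := Nat.le_ceil _
    have h3 : (1 - ε) / D * a ≤ (1 + ε) / D * a := by gcongr; linarith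
    exact_mod_cast h1.trans (h3.trans h2)
  have hn2k : n2 ≤ k := by
    have := (div_lt_div_iff_of_pos_right ha).1 h23
    exact_mod_cast this.le
  -- Increment `j` is governed by the walks at time `j + 1`, and `j < n1` gives exactly `j + 1 ≤
  -- n1`.
  have s1 : ∑ j ∈ Finset.range n1, I a j = ∑ j ∈ Finset.range n1, A j := by
    refine Finset.sum_congr rfl fun j hj => hIA a ha j fun l => ⟨e2 l _, e1 l _ ?_⟩
    have h1 : (n1 : ℝ) ≤ (1 - ε) / D * a := Nat.floor_le (by positivity)
    have h2 : ((j + 1 : ℕ) : ℝ) ≤ n1 := by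
      exact_mod_cast Finset.mem_range.1 hj
    exact h2.trans h1
  have s2 : -(∑ j ∈ Finset.range n2, V j - ∑ j ∈ Finset.range n1, V j)
      ≤ ∑ j ∈ Finset.Ico n1 n2, I a j := by
    rw [← Finset.sum_Ico_eq_sub _ hn12, ← Finset.sum_neg_distrib]
    exact Finset.sum_le_sum fun j _ => (abs_le.1 (hIV a ha j)).1
  have s3 : ∑ j ∈ Finset.Ico n2 k, I a j
      = ∑ j ∈ Finset.range k, B j - ∑ j ∈ Finset.range n2, B j := by
    rw [← Finset.sum_Ico_eq_sub _ hn2k]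
    refine Finset.sum_congr rfl fun j hj => hIB a ha j fun l => e3 l _ ?_
    have h2 : (1 + ε) / D * a ≤ (n2 : ℝ) := Nat.le_ceil _
    have h3 : (n2 : ℝ) ≤ ((j + 1 : ℕ) : ℝ) := by
      exact_mod_cast (Finset.mem_Ico.1 hj).1.trans (Nat.le_succ j)
    exact h2.trans h3
  rw [← Finset.sum_range_add_sum_Ico _ (hn12.trans hn2k),
    ← Finset.sum_Ico_consecutive _ hn12 hn2k, s1, s3]
  rw [← sub_div, ← sub_div, ← sub_div, ← add_div, one_lt_div ha] at hT
  linarith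

end Deterministic

/-! ### Domination and truncation in `L¹` -/

section UniformIntegrability

variable {Ω : Type*} [MeasurableSpace Ω] {P : Measure Ω}

/-- A family that is asymptotically bounded by `β` and is dominated, up to errors that are small
in `L¹`, exceeds `β` by an amount that tends to zero in `L¹`. -/
lemma tendsto_lintegral_excess {u : ℝ → Ω → ℝ≥0∞} (hu : ∀ a, Measurable (u a)) {β : ℝ≥0∞}
    (hβ : β ≠ ⊤) (hlim : ∀ᵐ ω ∂P, ∀ β' > β, ∀ᶠ a in atTop, u a ω ≤ β')
    (hdom : ∀ δ > 0, ∃ (G : Ω → ℝ≥0∞) (E : ℝ → Ω → ℝ≥0∞), Measurable G ∧ ∫⁻ ω, G ω ∂P ≠ ⊤ ∧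
      (∀ a, Measurable (E a)) ∧
      ∀ᶠ a in atTop, (∀ ω, u a ω ≤ G ω + E a ω) ∧ ∫⁻ ω, E a ω ∂P ≤ δ) :
    Tendsto (fun a => ∫⁻ ω, (u a ω - β) ∂P) atTop (𝓝 0) := by
  rw [ENNReal.tendsto_nhds_zero]
  intro ε hε
  obtain ⟨G, E, hG, hGint, hE, hGE⟩ := hdom (ε / 2) (ENNReal.half_pos hε.ne')
  -- The excess is at most `min (u - β) G + E`: the first term tends to zero by dominated
  -- convergence, and the second has small integral.
  have h0 : Tendsto (fun a => ∫⁻ ω, min (u a ω - β) (G ω) ∂P) atTop (𝓝 (∫⁻ _, 0 ∂P)) := by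
    refine tendsto_lintegral_filter_of_dominated_convergence G
      (Eventually.of_forall fun a => ((hu a).sub measurable_const).min hG)
      (Eventually.of_forall fun a => ae_of_all _ fun ω => min_le_right _ _) hGint ?_
    filter_upwards [hlim] with ω hω
    rw [ENNReal.tendsto_nhds_zero]
    intro η hη
    filter_upwards [hω (β + η) (ENNReal.lt_add_right hβ hη.ne')] with a ha
    exact (min_le_left _ _).trans (tsub_le_iff_left.2 ha)
  rw [lintegral_zero, ENNReal.tendsto_nhds_zero] at h0
  filter_upwards [hGE, h0 (ε / 2) (ENNReal.half_pos hε.ne')] with a ha h0a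
  calc ∫⁻ ω, (u a ω - β) ∂P ≤ ∫⁻ ω, (min (u a ω - β) (G ω) + E a ω) ∂P := by
        refine lintegral_mono fun ω => ?_
        rcases le_total (u a ω - β) (G ω) with h | h
        · simp [h]
        · simp only [min_eq_right h]
          exact tsub_le_self.trans (ha.1 ω)
    _ = ∫⁻ ω, min (u a ω - β) (G ω) ∂P + ∫⁻ ω, E a ω ∂P := lintegral_add_right _ (hE a)
    _ ≤ ε / 2 + ε / 2 := add_le_add h0a ha.2
    _ = ε := ENNReal.add_halves ε

/-- The indicator that time `j + 1` is at most `x`. -/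
noncomputable def timeLE (x : ℝ≥0∞) (j : ℕ) : ℝ≥0∞ := if ((j + 1 : ℕ) : ℝ≥0∞) ≤ x then 1 else 0

/-- The sum counts the positive integers that are at most `x`. -/
lemma tsum_timeLE_le (x : ℝ≥0∞) : ∑' j, timeLE x j ≤ x := by
  refine ENNReal.tsum_le_of_sum_range_le fun n => ?_
  -- The bound by `n` is carried along because, when `n + 1 ≤ x`, it is what bounds the next sum by
  -- `n + 1 ≤ x`.
  suffices h : ∑ j ∈ Finset.range n, timeLE x j ≤ n ∧ ∑ j ∈ Finset.range n, timeLE x j ≤ x from h.2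
  induction n with
  | zero => simp
  | succ n ih =>
    rw [Finset.sum_range_succ]
    by_cases h : ((n + 1 : ℕ) : ℝ≥0∞) ≤ x
    · have : ∑ j ∈ Finset.range n, timeLE x j + timeLE x n ≤ ((n + 1 : ℕ) : ℝ≥0∞) := by
        rw [timeLE, if_pos h, Nat.cast_add, Nat.cast_one]
        exact add_le_add ih.1 le_rfl
      exact ⟨this, this.trans h⟩
    · rw [timeLE, if_neg h, add_zero]
      exact ⟨ih.1.trans (by exact_mod_cast Nat.le_succ n), ih.2⟩

lemma measurable_timeLE (j : ℕ) : Measurable fun x => timeLE x j :=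
  Measurable.ite measurableSet_Ici measurable_const measurable_const

/-- Dominated convergence. This truncation is why plain integrability of the fusion bound suffices.
-/
lemma exists_lintegral_tsub_le {U : Ω → ℝ≥0∞} (hU : Measurable U) (hfin : ∫⁻ ω, U ω ∂P ≠ ⊤)
    {δ : ℝ≥0∞} (hδ : 0 < δ) : ∃ K : ℕ, ∫⁻ ω, (U ω - K) ∂P ≤ δ := by
  have h0 : Tendsto (fun K : ℕ => ∫⁻ ω, (U ω - K) ∂P) atTop (𝓝 (∫⁻ _, 0 ∂P)) := by
    refine tendsto_lintegral_filter_of_dominated_convergence U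
      (Eventually.of_forall fun a => hU.sub measurable_const)
      (Eventually.of_forall fun a => ae_of_all _ fun ω => tsub_le_self) hfin ?_
    filter_upwards [ae_lt_top hU hfin] with ω hω
    obtain ⟨n, hn⟩ := ENNReal.exists_nat_gt hω.ne
    refine tendsto_const_nhds.congr' ?_
    filter_upwards [eventually_ge_atTop n] with K hK
    refine (tsub_eq_zero_of_le (hn.le.trans ?_)).symm
    exact_mod_cast hK
  rw [lintegral_zero, ENNReal.tendsto_nhds_zero] at h0
  exact (h0 δ hδ).exists

/-- The sum of the excesses of `U j` over `K` up to the independent time `a * τ`. -/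
lemma lintegral_tsum_excess_le {U : ℕ → Ω → ℝ≥0∞} (hU : ∀ j, Measurable (U j))
    (hid : ∀ j, IdentDistrib (U j) (U 0) P P) {τ : Ω → ℝ≥0∞} (hτ : Measurable τ)
    (hind : ∀ j, IndepFun (U j) τ P) (K a : ℝ≥0∞) :
    ∫⁻ ω, ∑' j, (U j ω - K) * timeLE (a * τ ω) j ∂P
      ≤ (∫⁻ ω, (U 0 ω - K) ∂P) * (a * ∫⁻ ω, τ ω ∂P) := by
  have m1 : ∀ j, Measurable fun ω => U j ω - K := fun j => (hU j).sub measurable_const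
  have m2 : ∀ j, Measurable fun ω => timeLE (a * τ ω) j :=
    fun j => (measurable_timeLE j).comp (hτ.const_mul a)
  have m3 : ∀ j, Measurable fun ω => (U j ω - K) * timeLE (a * τ ω) j :=
    fun j => (m1 j).mul (m2 j)
  rw [lintegral_tsum fun j => (m3 j).aemeasurable]
  -- Wald's argument: independence factors each term, and identical distribution makes the first
  -- factor the same for all `j`.
  calc ∑' j, ∫⁻ ω, (U j ω - K) * timeLE (a * τ ω) j ∂P
      = ∑' j, (∫⁻ ω, (U 0 ω - K) ∂P) * ∫⁻ ω, timeLE (a * τ ω) j ∂P := by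
        refine tsum_congr fun j => ?_
        have hi : IndepFun (fun ω => U j ω - K) (fun ω => timeLE (a * τ ω) j) P :=
          (hind j).comp (φ := fun x => x - K) (ψ := fun x => timeLE (a * x) j)
            (measurable_id.sub measurable_const)
            ((measurable_timeLE j).comp (measurable_id.const_mul a))
        rw [lintegral_mul_eq_lintegral_mul_lintegral_of_indepFun'' (m1 j).aemeasurable
          (m2 j).aemeasurable hi]
        congr 1
        exact ((hid j).comp (u := fun x => x - K)
          (measurable_id.sub measurable_const)).lintegral_eq
    _ = (∫⁻ ω, (U 0 ω - K) ∂P) * ∫⁻ ω, ∑' j, timeLE (a * τ ω) j ∂P := by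
        rw [ENNReal.tsum_mul_left, lintegral_tsum fun j => (m2 j).aemeasurable]
    _ ≤ (∫⁻ ω, (U 0 ω - K) ∂P) * ∫⁻ ω, a * τ ω ∂P := by
        gcongr with ω
        exact tsum_timeLE_le _
    _ = _ := by rw [lintegral_const_mul _ hτ]

/-- The domination needed in `tendsto_lintegral_excess`, for a time bounded by a stopped sum. -/
lemma exists_domination [IsProbabilityMeasure P] {U : ℕ → Ω → ℝ≥0∞} (hU : ∀ j, Measurable (U j))
    (hid : ∀ j, IdentDistrib (U j) (U 0) P P) (hfin : ∫⁻ ω, U 0 ω ∂P ≠ ⊤)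
    {τ R : Ω → ℝ≥0∞} (hτ : Measurable τ) (hR : Measurable R)
    (hτfin : ∫⁻ ω, τ ω ∂P ≠ ⊤) (hRfin : ∫⁻ ω, R ω ∂P ≠ ⊤)
    (hind : ∀ j, IndepFun (U j) τ P) {c : ℝ≥0∞} (hc : c ≠ ⊤) {T : ℝ → Ω → ℝ≥0∞}
    (hT : ∀ a ≥ 1, ∀ ω, T a ω ≤ c * (ENNReal.ofReal a
      + ∑' j, 2 * U j ω * timeLE (ENNReal.ofReal a * τ ω) j + R ω) + 1)
    {δ : ℝ≥0∞} (hδ : 0 < δ) :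
    ∃ (G : Ω → ℝ≥0∞) (E : ℝ → Ω → ℝ≥0∞), Measurable G ∧ ∫⁻ ω, G ω ∂P ≠ ⊤ ∧
      (∀ a, Measurable (E a)) ∧
      ∀ᶠ a in atTop, (∀ ω, T a ω / ENNReal.ofReal a ≤ G ω + E a ω) ∧ ∫⁻ ω, E a ω ∂P ≤ δ := by
  -- With truncation error `δ / c'`, the term `E a` integrates to at most `δ`; the `+ 1` keeps `c'`
  -- nonzero.
  set c' := c * 2 * ∫⁻ ω, τ ω ∂P + 1
  have hc' : c' ≠ ⊤ := by finiteness
  obtain ⟨K, hK⟩ := exists_lintegral_tsub_le (hU 0) hfin (ENNReal.div_pos hδ.ne' hc')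
  have hm : ∀ A : ℝ≥0∞, Measurable fun ω => ∑' j, (U j ω - K) * timeLE (A * τ ω) j :=
    fun A => Measurable.tsum fun j =>
      ((hU j).sub measurable_const).mul ((measurable_timeLE j).comp (hτ.const_mul _))
  -- Split `U ≤ K + (U - K)`: the part `K` contributes at most `K * a * τ`, which after division by
  -- `a` goes into the fixed majorant, and the excess goes into `E a`.
  refine ⟨fun ω => c * (1 + 2 * K * τ ω + R ω) + 1, fun a ω => c * 2 * (ENNReal.ofReal a)⁻¹ *
    ∑' j, (U j ω - K) * timeLE (ENNReal.ofReal a * τ ω) j, by fun_prop, ?_, fun a => ?_, ?_⟩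
  · rw [lintegral_add_right _ measurable_const, lintegral_const_mul _ (by fun_prop),
      lintegral_add_right _ hR, lintegral_add_right _ (by fun_prop), lintegral_const_mul _ hτ]
    simp only [lintegral_const, measure_univ, mul_one]
    finiteness
  · exact (hm _).const_mul _
  · filter_upwards [eventually_ge_atTop 1] with a ha
    have ha0 : ENNReal.ofReal a ≠ 0 := by
      rw [Ne, ENNReal.ofReal_eq_zero]; linarith
    have ha1 : ENNReal.ofReal a ≠ ⊤ := ENNReal.ofReal_ne_top
    have hinv : (ENNReal.ofReal a)⁻¹ ≤ 1 :=
      ENNReal.inv_le_one.2 (ENNReal.one_le_ofReal.2 ha)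
    have hcancel : (ENNReal.ofReal a)⁻¹ * ENNReal.ofReal a = 1 := ENNReal.inv_mul_cancel ha0 ha1
    refine ⟨fun ω => ?_, ?_⟩
    · set A := ENNReal.ofReal a
      set e := ∑' j, (U j ω - K) * timeLE (A * τ ω) j
      have hsum : ∑' j, 2 * U j ω * timeLE (A * τ ω) j ≤ 2 * K * (A * τ ω) + 2 * e := by
        calc ∑' j, 2 * U j ω * timeLE (A * τ ω) j
            ≤ ∑' j, (2 * K * timeLE (A * τ ω) j + 2 * ((U j ω - K) * timeLE (A * τ ω) j)) := by
              refine ENNReal.tsum_le_tsum fun j => ?_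
              rw [← mul_assoc 2 (U j ω - K), ← add_mul, ← mul_add]
              gcongr
              exact le_add_tsub
          _ = 2 * K * ∑' j, timeLE (A * τ ω) j + 2 * e := by
              rw [ENNReal.tsum_add, ENNReal.tsum_mul_left, ENNReal.tsum_mul_left]
          _ ≤ _ := by gcongr; exact tsum_timeLE_le _
      calc T a ω / A ≤ (c * (A + (2 * K * (A * τ ω) + 2 * e) + R ω) + 1) / A := by
            gcongr
            refine (hT a ha ω).trans ?_
            gcongr
        _ = c * (A⁻¹ * A + 2 * K * (A⁻¹ * A * τ ω) + A⁻¹ * R ω) + A⁻¹ * 1 + c * 2 * A⁻¹ * e := by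
            rw [div_eq_mul_inv]; ring
        _ ≤ c * (1 + 2 * K * τ ω + R ω) + 1 + c * 2 * A⁻¹ * e := by
            rw [hcancel, one_mul, mul_one]
            gcongr
            exact mul_le_of_le_one_left' hinv
    · set A := ENNReal.ofReal a
      rw [lintegral_const_mul _ (hm A)]
      calc c * 2 * A⁻¹ * ∫⁻ ω, ∑' j, (U j ω - K) * timeLE (A * τ ω) j ∂P
          ≤ c * 2 * A⁻¹ * ((δ / c') * (A * ∫⁻ ω, τ ω ∂P)) := by
            gcongr
            exact (lintegral_tsum_excess_le hU hid hτ hind K A).trans (by gcongr)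
        _ = (A⁻¹ * A) * (δ / c') * (c * 2 * ∫⁻ ω, τ ω ∂P) := by ring
        _ ≤ δ / c' * c' := by
            rw [hcancel, one_mul]; gcongr; exact le_self_add
        _ ≤ δ := (ENNReal.div_mul_cancel (by simp [c']) hc').le

end UniformIntegrability

/-! ### Pathwise bound on the crossing time -/

section Pathwise

/-- The time by which every local statistic has settled above its threshold, when the thresholds
are `d l / D` and the deviations of the statistics are at most `R l`. -/
noncomputable def settlingTime {ι : Type*} [Fintype ι] (D : ℝ) (d : ι → ℝ) (R : ι → ℝ≥0∞) : ℝ≥0∞ :=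
  ENNReal.ofReal (2 / D) + ∑ l, ENNReal.ofReal (2 / d l) * R l

/-- The largest amount by which the partial sums of `x` fall short of the line of slope `m`. -/
noncomputable def shortfall (m : ℝ) (x : ℕ → ℝ) : ℝ≥0∞ :=
  ⨆ k, ENNReal.ofReal (∑ j ∈ Finset.range k, (m - x j))

/-- A walk still below its threshold at time `k` falls short of slope `d l / 2` by more than `d l /
2 * k - d l / D * a`; solve for `k`. As `a ≥ 1`, the shortfall may be multiplied by `a`, so the
bound is `a` times a quantity free of `a`. -/
lemma le_settlingTime {ι : Type*} [Fintype ι] {w : ι → ℕ → ℝ} {D : ℝ} {d : ι → ℝ}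
    (hd : ∀ l, 0 < d l) (hD : 0 < D) {a : ℝ} (ha : 1 ≤ a) {k : ℕ} {l : ι}
    (hk : ∑ j ∈ Finset.range k, w l j < d l / D * a) :
    (k : ℝ≥0∞) ≤ ENNReal.ofReal a * settlingTime D d fun l => shortfall (d l / 2) (w l) := by
  have hs : ENNReal.ofReal (d l / 2 * k - d l / D * a) ≤ shortfall (d l / 2) (w l) := by
    refine le_trans (ENNReal.ofReal_le_ofReal ?_)
      (le_iSup (fun k => ENNReal.ofReal (∑ j ∈ Finset.range k, (d l / 2 - w l j))) k)
    rw [Finset.sum_sub_distrib, Finset.sum_const, Finset.card_range, nsmul_eq_mul]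
    linarith
  have hdl := hd l
  calc (k : ℝ≥0∞) = ENNReal.ofReal (a * (2 / D) + 2 / d l * (d l / 2 * k - d l / D * a)) := by
        rw [← ENNReal.ofReal_natCast]
        congr 1
        field_simp
        ring
    _ ≤ ENNReal.ofReal a * ENNReal.ofReal (2 / D)
        + ENNReal.ofReal (2 / d l) * ENNReal.ofReal (d l / 2 * k - d l / D * a) := by
        refine ENNReal.ofReal_add_le.trans ?_
        rw [ENNReal.ofReal_mul (by linarith), ENNReal.ofReal_mul (by positivity)]
    _ ≤ ENNReal.ofReal a * ENNReal.ofReal (2 / D) + ENNReal.ofReal a *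
        ∑ l, ENNReal.ofReal (2 / d l) * shortfall (d l / 2) (w l) := by
        refine add_le_add le_rfl ?_
        refine le_trans ?_ (le_mul_of_one_le_left' (ENNReal.one_le_ofReal.2 ha))
        refine le_trans ?_ (Finset.single_le_sum
          (f := fun l => ENNReal.ofReal (2 / d l) * shortfall (d l / 2) (w l))
          (fun _ _ => zero_le) (Finset.mem_univ l))
        gcongr
    _ = _ := by rw [settlingTime, mul_add]

/-- A pathwise bound for the first time at which the sum of the fusion increments reaches `a`. -/
lemma le_of_shortfall {ι : Type*} [Fintype ι] {w : ι → ℕ → ℝ} {D : ℝ} {d : ι → ℝ}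
    (hd : ∀ l, 0 < d l) (hD : 0 < D) {I B V : ℕ → ℝ} (hIV : ∀ j, |I j| ≤ V j)
    (hBV : ∀ j, |B j| ≤ V j) {a : ℝ} (ha : 1 ≤ a)
    (hIB : ∀ j, (∀ l, d l / D * a ≤ ∑ i ∈ Finset.range (j + 1), w l i) → I j = B j)
    {Δ : ℝ} (hΔ : 0 < Δ) {T : ℝ≥0∞}
    (hT : ∀ k : ℕ, a ≤ ∑ j ∈ Finset.range k, I j → T ≤ k) :
    T ≤ ENNReal.ofReal (2 / Δ) * (ENNReal.ofReal a + ∑' j, 2 * ENNReal.ofReal (V j) *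
      timeLE (ENNReal.ofReal a * settlingTime D d fun l => shortfall (d l / 2) (w l)) j
      + shortfall (Δ / 2) B) + 1 := by
  set x := ENNReal.ofReal a * settlingTime D d fun l => shortfall (d l / 2) (w l)
  set G := ∑' j, 2 * ENNReal.ofReal (V j) * timeLE x j with hG
  set R := shortfall (Δ / 2) B with hR
  have hV : ∀ j, 0 ≤ V j := fun j => (abs_nonneg _).trans (hIV j)
  by_cases hS : ENNReal.ofReal a + G + R = ⊤
  · rw [hS, ENNReal.mul_top, top_add]
    · exact le_top
    · rw [Ne, ENNReal.ofReal_eq_zero, not_le]; positivity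
  have hRt : R ≠ ⊤ := fun h => hS (by rw [h, add_top])
  have hGt : G ≠ ⊤ := fun h => hS (by rw [h, add_top, top_add])
  set s := a + G.toReal + R.toReal
  have hs0 : 0 ≤ s := by positivity
  have hSs : ENNReal.ofReal a + G + R = ENNReal.ofReal s := by
    rw [ENNReal.ofReal_add (by positivity) (by positivity), ENNReal.ofReal_add (by positivity)
      (by positivity), ENNReal.ofReal_toReal hRt, ENNReal.ofReal_toReal hGt]
  -- At this `k` the line of slope `Δ / 2` has reached `s`, which pays for the threshold `a`, the
  -- loss `G` at unsettled times and the shortfall `R`. The ceiling costs the final `+ 1`.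
  set k := ⌈2 / Δ * s⌉₊
  have hk1 : 2 / Δ * s ≤ k := Nat.le_ceil _
  have hk2 : (k : ℝ) ≤ 2 / Δ * s + 1 := (Nat.ceil_lt_add_one (by positivity)).le
  refine (hT k ?_).trans ?_
  -- At an unsettled time `I ≥ -V ≥ B - 2 * V`; at a settled one `I = B`.
  · have h1 : ∑ j ∈ Finset.range k, (B j - 2 * V j * (timeLE x j).toReal)
        ≤ ∑ j ∈ Finset.range k, I j := by
      refine Finset.sum_le_sum fun j _ => ?_
      by_cases h : ∀ l, d l / D * a ≤ ∑ i ∈ Finset.range (j + 1), w l i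
      · rw [hIB j h]
        have : 0 ≤ 2 * V j * (timeLE x j).toReal :=
          mul_nonneg (mul_nonneg two_pos.le (hV j)) ENNReal.toReal_nonneg
        linarith
      · push Not at h
        obtain ⟨l, hl⟩ := h
        rw [timeLE, if_pos (le_settlingTime hd hD ha hl), ENNReal.toReal_one]
        have h1 := (abs_le.1 (hIV j)).1
        have h2 := (abs_le.1 (hBV j)).2
        linarith
    have h2 : ∑ j ∈ Finset.range k, 2 * V j * (timeLE x j).toReal ≤ G.toReal := by
      have h3 : ∑ j ∈ Finset.range k, 2 * V j * (timeLE x j).toReal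
          = (∑ j ∈ Finset.range k, 2 * ENNReal.ofReal (V j) * timeLE x j).toReal := by
        rw [ENNReal.toReal_sum]
        · refine Finset.sum_congr rfl fun j _ => ?_
          rw [ENNReal.toReal_mul, ENNReal.toReal_mul, ENNReal.toReal_ofReal (hV j)]
          rfl
        · intro j _
          have : timeLE x j ≠ ⊤ := by unfold timeLE; split_ifs <;> simp
          finiteness
      rw [h3]
      exact ENNReal.toReal_mono hGt (ENNReal.sum_le_tsum _)
    have h4 : ∑ j ∈ Finset.range k, (Δ / 2 - B j) ≤ R.toReal := by
      rw [← ENNReal.ofReal_le_iff_le_toReal hRt]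
      exact le_iSup (fun k => ENNReal.ofReal (∑ j ∈ Finset.range k, (Δ / 2 - B j))) k
    rw [Finset.sum_sub_distrib] at h1
    rw [Finset.sum_sub_distrib, Finset.sum_const, Finset.card_range, nsmul_eq_mul] at h4
    have h5 : s ≤ k * (Δ / 2) := by
      have : 2 / Δ * s * (Δ / 2) ≤ k * (Δ / 2) := by gcongr
      have e : 2 / Δ * s * (Δ / 2) = s := by field_simp
      linarith
    linarith
  · rw [hSs, ← ENNReal.ofReal_mul (by positivity), ← ENNReal.ofReal_one,
      ← ENNReal.ofReal_add (by positivity) one_pos.le, ← ENNReal.ofReal_natCast]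
    exact ENNReal.ofReal_le_ofReal hk2

end Pathwise

/-! ### Asymptotics of an abstract crossing time -/

section Abstract

lemma measurable_shortfall {α : Type*} [MeasurableSpace α] (m : ℝ) {x : ℕ → α → ℝ}
    (hx : ∀ j, Measurable (x j)) : Measurable fun y => shortfall m fun j => x j y :=
  Measurable.iSup fun _ => (Finset.measurable_sum _ fun j _ =>
    measurable_const.sub (hx j)).ennreal_ofReal

lemma measurable_settlingTime {α ι : Type*} [MeasurableSpace α] [Fintype ι] (D : ℝ) (d : ι → ℝ)
    {x : ι → ℕ → α → ℝ} (hx : ∀ l j, Measurable (x l j)) :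
    Measurable fun y => settlingTime D d fun l => shortfall (d l / 2) fun j => x l j y := by
  unfold settlingTime
  have h : ∀ l, Measurable fun y =>
      ENNReal.ofReal (2 / d l) * shortfall (d l / 2) fun j => x l j y :=
    fun l => (measurable_shortfall _ (hx l)).const_mul _
  exact measurable_const.add (Finset.measurable_sum _ fun l _ => h l)

variable {Ω : Type*} [MeasurableSpace Ω] {P : Measure Ω} [IsProbabilityMeasure P]

/-- For `m` below the mean, the walk with increments `m - X j` has negative drift. -/
lemma lintegral_shortfall_lt_top {X : ℕ → Ω → ℝ} (hX : ∀ k, Measurable (X k))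
    (hind : iIndepFun X P) (hid : ∀ k, IdentDistrib (X k) (X 0) P P) (h2 : MemLp (X 0) 2 P)
    {m : ℝ} (hm : m < ∫ ω, X 0 ω ∂P) : ∫⁻ ω, shortfall m (fun j => X j ω) ∂P < ⊤ := by
  have hg : Measurable fun x : ℝ => m - x := measurable_const.sub measurable_id
  refine lintegral_iSup_sum_lt_top (X := fun j ω => m - X j ω) (fun k => hg.comp (hX k))
    (hind.comp (fun _ x => m - x) fun _ => hg) (fun k => (hid k).comp hg)
    ((memLp_const m).sub h2) ?_
  rw [integral_sub (integrable_const m) (h2.integrable (by norm_num))]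
  simpa using hm

/-- Asymptotics of the first time at which a sum of dependent increments `I` reaches `a`, when
the increments are governed by random walks `w l` crossing thresholds `d l / D * a`. -/
theorem asymptotic_crossing_time {ι : Type*} [Fintype ι] {w : ι → ℕ → Ω → ℝ} {d r : ι → ℝ} {D : ℝ}
    (hd : ∀ l, 0 < d l) (hr : ∀ l, 0 < r l) (hD : 0 < D)
    (hw : ∀ l k, Measurable (w l k)) (hwind : ∀ l, iIndepFun (w l) P)
    (hwid : ∀ l k, IdentDistrib (w l k) (w l 0) P P) (hw2 : ∀ l, MemLp (w l 0) 2 P)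
    (hwmean : ∀ l, ∫ ω, w l 0 ω ∂P = d l)
    {A B V : ℕ → Ω → ℝ} {Δ q : ℝ}
    (hAind : iIndepFun A P) (hAid : ∀ k, IdentDistrib (A k) (A 0) P P)
    (hAint : Integrable (A 0) P) (hAmean : -q ≤ ∫ ω, A 0 ω ∂P) (hq : 0 ≤ q)
    (hB : ∀ k, Measurable (B k)) (hBind : iIndepFun B P)
    (hBid : ∀ k, IdentDistrib (B k) (B 0) P P) (hB2 : MemLp (B 0) 2 P)
    (hBmean : ∫ ω, B 0 ω ∂P = Δ) (hΔ : 0 < Δ)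
    (hV : ∀ k, Measurable (V k)) (hVind : iIndepFun V P)
    (hVid : ∀ k, IdentDistrib (V k) (V 0) P P) (hVint : Integrable (V 0) P)
    (hVw : ∀ j, IndepFun (V j) (fun ω (p : ℕ × ι) => w p.2 p.1 ω) P)
    (hBV : ∀ j ω, |B j ω| ≤ V j ω)
    {I : ℝ → ℕ → Ω → ℝ} (hIV : ∀ a > 0, ∀ j ω, |I a j ω| ≤ V j ω)
    (hIB : ∀ a > 0, ∀ j ω, (∀ l, d l / D * a ≤ ∑ i ∈ Finset.range (j + 1), w l i ω) →
      I a j ω = B j ω)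
    (hIA : ∀ a > 0, ∀ j ω, (∀ l, -(r l * a) < ∑ i ∈ Finset.range (j + 1), w l i ω ∧
      ∑ i ∈ Finset.range (j + 1), w l i ω < d l / D * a) → I a j ω = A j ω)
    {T : ℝ → Ω → ℝ≥0∞} (hTm : ∀ a, Measurable (T a))
    (hT : ∀ a > 0, ∀ ω, ∀ k : ℕ, a ≤ ∑ j ∈ Finset.range k, I a j ω → T a ω ≤ k) :
    (∀ᵐ ω ∂P, ∀ β' > ENNReal.ofReal (1 / D + (1 + q / D) / Δ), ∀ᶠ a in atTop,
      T a ω / ENNReal.ofReal a ≤ β') ∧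
    Tendsto (fun a => ∫⁻ ω, (T a ω / ENNReal.ofReal a
      - ENNReal.ofReal (1 / D + (1 + q / D) / Δ)) ∂P) atTop (𝓝 0) := by
  have h1 : ∀ᵐ ω ∂P, ∀ β' > ENNReal.ofReal (1 / D + (1 + q / D) / Δ), ∀ᶠ a in atTop,
      T a ω / ENNReal.ofReal a ≤ β' := by
    have slln : ∀ {X : ℕ → Ω → ℝ}, iIndepFun X P → (∀ k, IdentDistrib (X k) (X 0) P P) →
        Integrable (X 0) P → ∀ᵐ ω ∂P, Tendsto (fun n : ℕ =>
          (∑ j ∈ Finset.range n, X j ω) / n) atTop (𝓝 (∫ ω, X 0 ω ∂P)) :=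
      fun hi hid hint => strong_law_ae_real _ hint (fun i j hij => hi.indepFun hij) hid
    filter_upwards [ae_all_iff.2 fun l => slln (hwind l) (hwid l)
      ((hw2 l).integrable (by norm_num)), slln hAind hAid hAint,
      slln hBind hBid (hB2.integrable (by norm_num)), slln hVind hVid hVint] with ω eW eA eB eV
    intro β' hβ'
    rcases eq_or_ne β' ⊤ with rfl | htop
    · simp
    have ht : 1 / D + (1 + q / D) / Δ < β'.toReal := by
      rw [← ENNReal.ofReal_toReal htop] at hβ'
      exact (ENNReal.ofReal_lt_ofReal_iff_of_nonneg (by positivity)).1 hβ'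
    have ht0 : 0 < β'.toReal := lt_of_le_of_lt (by positivity) ht
    rw [hBmean] at eB
    have key := eventually_le_sum_range (W := fun k l => ∑ i ∈ Finset.range k, w l i ω) hd hr hD
      (fun l => by simpa only [hwmean l] using eW l) eA eB eV
      (I := fun a j => I a j ω) (fun a ha j => hIV a ha j ω) (fun a ha j h => hIB a ha j ω h)
      (fun a ha j h => hIA a ha j ω h) hΔ hq hAmean ht
    filter_upwards [key, eventually_gt_atTop 0] with a ha ha0
    refine ENNReal.div_le_of_le_mul ((hT a ha0 ω _ ha).trans ?_)
    rw [← ENNReal.ofReal_natCast]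
    calc ENNReal.ofReal (⌊β'.toReal * a⌋₊ : ℝ) ≤ ENNReal.ofReal (β'.toReal * a) :=
          ENNReal.ofReal_le_ofReal (Nat.floor_le (by positivity))
      _ = β' * ENNReal.ofReal a := by
          rw [ENNReal.ofReal_mul ht0.le, ENNReal.ofReal_toReal htop]
  refine ⟨h1, tendsto_lintegral_excess (fun a => (hTm a).div_const _) ENNReal.ofReal_ne_top h1 ?_⟩
  intro δ hδ
  -- The settling time is a measurable function of the whole array of local increments, so it
  -- inherits the array's independence of each `V j`.
  have hτm : Measurable fun x : ℕ × ι → ℝ =>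
      settlingTime D d fun l => shortfall (d l / 2) fun j => x (j, l) := by
    exact measurable_settlingTime D d fun l j => measurable_pi_apply (j, l)
  have hsf : ∀ l, Measurable fun ω => shortfall (d l / 2) fun j => w l j ω :=
    fun l => measurable_shortfall _ (hw l)
  have hsf' : ∀ l, Measurable fun ω =>
      ENNReal.ofReal (2 / d l) * shortfall (d l / 2) fun j => w l j ω :=
    fun l => (hsf l).const_mul _
  set τ : Ω → ℝ≥0∞ := fun ω => settlingTime D d fun l => shortfall (d l / 2) fun j => w l j ω
    with hτ
  have hτmeas : Measurable τ := measurable_settlingTime D d hw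
  have hτfin : ∫⁻ ω, τ ω ∂P ≠ ⊤ := by
    simp only [hτ, settlingTime]
    rw [lintegral_add_left measurable_const, lintegral_finsetSum _ fun l _ => hsf' l]
    simp only [lintegral_const, measure_univ, mul_one]
    refine ENNReal.add_ne_top.2 ⟨ENNReal.ofReal_ne_top, ENNReal.sum_ne_top.2 fun l _ => ?_⟩
    rw [lintegral_const_mul _ (hsf l)]
    refine ENNReal.mul_ne_top ENNReal.ofReal_ne_top
      (lintegral_shortfall_lt_top (hw l) (hwind l) (hwid l) (hw2 l) ?_).ne
    rw [hwmean l]; linarith [hd l]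
  have hτV : ∀ j, IndepFun (fun ω => ENNReal.ofReal (V j ω)) τ P := fun j =>
    (hVw j).comp (φ := ENNReal.ofReal) (ψ := fun x : ℕ × ι → ℝ =>
      settlingTime D d fun l => shortfall (d l / 2) fun j => x (j, l))
      ENNReal.measurable_ofReal hτm
  have hVfin : ∫⁻ ω, ENNReal.ofReal (V 0 ω) ∂P ≠ ⊤ := by
    rw [← ofReal_integral_eq_lintegral_ofReal hVint
      (ae_of_all _ fun ω => (abs_nonneg _).trans (hBV 0 ω))]
    exact ENNReal.ofReal_ne_top
  have hRfin : ∫⁻ ω, shortfall (Δ / 2) (fun j => B j ω) ∂P ≠ ⊤ :=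
    (lintegral_shortfall_lt_top hB hBind hBid hB2 (by rw [hBmean]; linarith)).ne
  have hVid' : ∀ j, IdentDistrib (fun ω => ENNReal.ofReal (V j ω))
      (fun ω => ENNReal.ofReal (V 0 ω)) P P := fun j => (hVid j).comp ENNReal.measurable_ofReal
  refine exists_domination (U := fun j ω => ENNReal.ofReal (V j ω))
    (fun j => (hV j).ennreal_ofReal) hVid' hVfin hτmeas (measurable_shortfall _ hB) hτfin hRfin
    hτV (c := ENNReal.ofReal (2 / Δ)) ENNReal.ofReal_ne_top ?_ hδ
  intro a ha ω
  have ha0 : 0 < a := by linarith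
  exact le_of_shortfall (w := fun l j => w l j ω) (I := fun j => I a j ω)
    (B := fun j => B j ω) (V := fun j => V j ω) hd hD (fun j => hIV a ha0 j ω)
    (fun j => hBV j ω) ha (fun j h => hIB a ha0 j ω h) hΔ (fun k h => hT a ha0 ω k h)

end Abstract

/-! ### From the threshold `a` to `c → 0` -/

section Threshold

/-- Asymptotic bounds as the threshold `a` tends to infinity, in terms of `c` where
`a = |log c|`. -/
lemma limsup_comp_abs_log {Ω : Type*} [MeasurableSpace Ω] {P : Measure Ω} [IsProbabilityMeasure P]
    {T : ℝ → Ω → ℝ≥0∞} {β : ℝ≥0∞} (hTm : ∀ a, Measurable (T a))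
    (hT : (∀ᵐ ω ∂P, ∀ β' > β, ∀ᶠ a in atTop, T a ω / ENNReal.ofReal a ≤ β') ∧
      Tendsto (fun a => ∫⁻ ω, (T a ω / ENNReal.ofReal a - β) ∂P) atTop (𝓝 0)) :
    (∀ᵐ ω ∂P, limsup (fun c : ℝ => T |Real.log c| ω / ENNReal.ofReal |Real.log c|) (𝓝[>] 0)
      ≤ β) ∧
    Tendsto (fun c : ℝ => ∫⁻ ω, (T |Real.log c| ω / ENNReal.ofReal |Real.log c| - β) ∂P)
      (𝓝[>] 0) (𝓝 0) ∧
    limsup (fun c : ℝ => (∫⁻ ω, T |Real.log c| ω ∂P) / ENNReal.ofReal |Real.log c|) (𝓝[>] 0)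
      ≤ β := by
  obtain ⟨h1, h2⟩ := hT
  have hlog : Tendsto (fun c : ℝ => |Real.log c|) (𝓝[>] 0) atTop :=
    tendsto_abs_atBot_atTop.comp Real.tendsto_log_nhdsGT_zero
  have h2' := h2.comp hlog
  refine ⟨?_, h2', ?_⟩
  · filter_upwards [h1] with ω hω
    refine le_of_forall_gt_imp_ge_of_dense fun β' hβ' => ?_
    exact limsup_le_of_le (h := hlog.eventually (hω β' hβ'))
  · refine le_of_forall_gt_imp_ge_of_dense fun β' hβ' => ?_
    refine limsup_le_of_le (h := ?_)
    filter_upwards [ENNReal.tendsto_nhds_zero.1 h2' (β' - β) (tsub_pos_of_lt hβ')] with c hc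
    calc (∫⁻ ω, T |Real.log c| ω ∂P) / ENNReal.ofReal |Real.log c|
        = ∫⁻ ω, T |Real.log c| ω / ENNReal.ofReal |Real.log c| ∂P := by
          simp_rw [div_eq_mul_inv]
          rw [lintegral_mul_const _ (hTm _)]
      _ ≤ ∫⁻ ω, ((T |Real.log c| ω / ENNReal.ofReal |Real.log c| - β) + β) ∂P :=
          lintegral_mono fun ω => le_tsub_add
      _ = ∫⁻ ω, (T |Real.log c| ω / ENNReal.ofReal |Real.log c| - β) ∂P + β := by
          rw [lintegral_add_right _ measurable_const]
          simp
      _ ≤ (β' - β) + β := by gcongr; exact hc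
      _ = β' := tsub_add_cancel_of_le hβ'.le

end Threshold

/-! ### Mean log-likelihood ratio and divergence -/

section Divergence

/-- Absolute continuity makes `p` vanish almost everywhere on `q = 0`, so `q * (p / q) = p` there
too, with the convention `p / 0 = 0`. -/
lemma law_eq_withDensity_div {ν : Measure ℝ} {p q : ℝ → ℝ} (hp : Measurable p) (hq : Measurable q)
    (hq0 : ∀ x, 0 ≤ q x) (hac : law ν p ≪ law ν q) :
    law ν p = (law ν q).withDensity fun x => ENNReal.ofReal (p x / q x) := by
  have hZ : MeasurableSet {x | q x = 0} := hq (measurableSet_singleton 0)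
  have hz : law ν p {x | q x = 0} = 0 := by
    refine hac ?_
    rw [law, withDensity_apply _ hZ]
    refine (setLIntegral_congr_fun (g := fun _ => 0) hZ fun x hx => ?_).trans lintegral_zero
    simp only [Set.mem_ofPred_eq] at hx
    simp [hx]
  rw [law, withDensity_apply _ hZ, setLIntegral_eq_zero_iff hZ hp.ennreal_ofReal] at hz
  have hpq : Measurable fun x => ENNReal.ofReal (p x / q x) := (hp.div hq).ennreal_ofReal
  rw [law, law, ← withDensity_mul _ hq.ennreal_ofReal hpq]
  refine withDensity_congr_ae ?_
  filter_upwards [hz] with x hx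
  rw [Pi.mul_apply, ← ENNReal.ofReal_mul (hq0 x)]
  by_cases h : q x = 0
  · have := hx h
    simp [h, this]
  · congr 1
    field_simp

/-- The mean log-likelihood ratio is the divergence. -/
lemma integral_log_div_eq_klDiv {ν : Measure ℝ} {p q : ℝ → ℝ} (hp : Measurable p)
    (hq : Measurable q) (hp0 : ∀ x, 0 ≤ p x) (hq0 : ∀ x, 0 ≤ q x)
    [IsProbabilityMeasure (law ν p)] [IsProbabilityMeasure (law ν q)]
    (hfin : InformationTheory.klDiv (law ν p) (law ν q) ≠ ⊤) :
    ∫ x, Real.log (p x / q x) ∂(law ν p) =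
      (InformationTheory.klDiv (law ν p) (law ν q)).toReal := by
  obtain ⟨hac, -⟩ := InformationTheory.klDiv_ne_top_iff.1 hfin
  rw [InformationTheory.toReal_klDiv_of_measure_eq hac (by simp)]
  refine integral_congr_ae ?_
  have h := Measure.rnDeriv_withDensity (law ν q) (f := fun x => ENNReal.ofReal (p x / q x))
    (hp.div hq).ennreal_ofReal
  rw [← law_eq_withDensity_div hp hq hq0 hac] at h
  filter_upwards [hac.ae_le h] with x hx
  rw [llr, hx, ENNReal.toReal_ofReal (div_nonneg (hp0 x) (hq0 x))]

end Divergence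

/-! ### The signals and stopping time of DualSPRT -/

section Concrete

/-- The sign that turns a log-likelihood ratio for `H_1` against `H_0` into one for `H_i`. -/
noncomputable def sgn (i : Fin 2) : ℝ := if i = 0 then -1 else 1

lemma abs_sgn (i : Fin 2) : |sgn i| = 1 := by
  fin_cases i <;> simp [sgn]

lemma sgn_mul_self (i : Fin 2) : sgn i * sgn i = 1 := by
  fin_cases i <;> simp [sgn]

variable {Ω : Type*} {L : ℕ}

lemma measurable_localLLR {f : Fin 2 → ℝ → ℝ} (hf : ∀ i, Measurable (f i)) :
    Measurable (localLLR f) := ((hf 1).div (hf 0)).log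

lemma measurable_fusionLLR {g : ℝ → ℝ} (hg : Measurable g) (μ : Fin 2 → ℝ) :
    Measurable (fusionLLR g μ) :=
  ((hg.comp (measurable_id.sub measurable_const)).div
    (hg.comp (measurable_id.add measurable_const))).log

lemma sgn_mul_localLLR (f : Fin 2 → ℝ → ℝ) (i : Fin 2) (x : ℝ) :
    sgn i * localLLR f x = Real.log (f i x / f (1 - i) x) := by
  fin_cases i
  · simp [sgn, localLLR, ← Real.log_inv]
  · simp [sgn, localLLR]

/-- `x² ≤ 1 + |x| ^ (α + 1)` because `α + 1 > 2`. The argument uses only second moments. -/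
lemma memLp_two_of_integrable_rpow [MeasurableSpace Ω] {P : Measure Ω} [IsFiniteMeasure P]
    {X : Ω → ℝ} (hX : Measurable X) {α : ℝ} (hα : 1 < α)
    (h : Integrable (fun ω => |X ω| ^ (α + 1)) P) : MemLp X 2 P := by
  rw [memLp_two_iff_integrable_sq hX.aestronglyMeasurable]
  refine ((integrable_const (1 : ℝ)).add h).mono' (hX.pow_const 2).aestronglyMeasurable
    (ae_of_all _ fun ω => ?_)
  rw [Real.norm_of_nonneg (sq_nonneg _), Pi.add_apply, ← sq_abs]
  have h0 := abs_nonneg (X ω)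
  rcases le_total |X ω| 1 with h1 | h1
  · have := Real.rpow_nonneg h0 (α + 1)
    nlinarith
  · have h2 : |X ω| ^ (2 : ℝ) ≤ |X ω| ^ (α + 1) :=
      Real.rpow_le_rpow_of_exponent_le h1 (by linarith)
    rw [Real.rpow_two] at h2
    linarith

/-- The three signals that a node may transmit. -/
noncomputable def signal (b : Fin 2 → ℝ) : Fin 3 → ℝ := ![0, b 0, b 1]

/-- The sum of the absolute values of the fusion increments over all patterns of signals. -/
noncomputable def incrBound (L : ℕ) (b : Fin 2 → ℝ) (g : ℝ → ℝ) (μ : Fin 2 → ℝ) (z : ℝ) : ℝ :=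
  ∑ p : Fin L → Fin 3, |fusionLLR g μ (∑ l, signal b (p l) + z)|

lemma measurable_incrBound (b : Fin 2 → ℝ) {g : ℝ → ℝ} (hg : Measurable g) (μ : Fin 2 → ℝ) :
    Measurable (incrBound L b g μ) :=
  Finset.measurable_sum _ fun _ _ => ((measurable_fusionLLR hg μ).comp
    (measurable_const.add measurable_id)).abs

/-- Bounds the fusion increment by a function of the noise alone, removing its dependence on the
local decisions. -/
lemma abs_fusionLLR_le_incrBound (b : Fin 2 → ℝ) (g : ℝ → ℝ) (μ : Fin 2 → ℝ) (z : ℝ)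
    {y : Fin L → ℝ} (hy : ∀ l, y l = 0 ∨ y l = b 0 ∨ y l = b 1) :
    |fusionLLR g μ (∑ l, y l + z)| ≤ incrBound L b g μ z := by
  have : ∀ l, ∃ p : Fin 3, y l = signal b p := fun l => by
    rcases hy l with h | h | h
    · exact ⟨0, h⟩
    · exact ⟨1, h⟩
    · exact ⟨2, h⟩
  choose p hp using this
  simp_rw [hp]
  exact Finset.single_le_sum (f := fun p : Fin L → Fin 3 =>
    |fusionLLR g μ (∑ l, signal b (p l) + z)|) (fun _ _ => abs_nonneg _) (Finset.mem_univ p)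

/-- Positive thresholds exclude that both indicators fire, so `b 0 + b 1` is never sent. -/
lemma transmit_mem {b : Fin 2 → ℝ} {γ₀ γ₁ : ℝ} (h₀ : 0 < γ₀) (h₁ : 0 < γ₁) (w : ℝ) :
    transmit b γ₀ γ₁ w = 0 ∨ transmit b γ₀ γ₁ w = b 0 ∨ transmit b γ₀ γ₁ w = b 1 := by
  unfold transmit
  split_ifs with h h'
  · linarith
  all_goals simp

lemma transmit_correct {b : Fin 2 → ℝ} {γ : Fin 2 → ℝ} (h : ∀ i, 0 < γ i) (i : Fin 2) {w : ℝ}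
    (hw : γ i ≤ sgn i * w) : transmit b (γ 0) (γ 1) w = b i := by
  have h0 := h 0
  have h1 := h 1
  fin_cases i
  · simp only [sgn, Fin.zero_eta, if_true] at hw
    rw [transmit, if_neg (by linarith), if_pos (by linarith), zero_add]
    rfl
  · simp only [sgn, Fin.mk_one, one_ne_zero, if_false] at hw
    rw [transmit, if_pos (by linarith), if_neg (by linarith), add_zero]
    rfl

lemma transmit_silent {b : Fin 2 → ℝ} {γ : Fin 2 → ℝ} (i : Fin 2) {w : ℝ}
    (hw : -γ (1 - i) < sgn i * w ∧ sgn i * w < γ i) : transmit b (γ 0) (γ 1) w = 0 := by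
  fin_cases i
  · simp [sgn] at hw
    rw [transmit, if_neg (by linarith [hw.1]), if_neg (by linarith [hw.2]), zero_add]
  · simp [sgn] at hw
    rw [transmit, if_neg (by linarith [hw.2]), if_neg (by linarith [hw.1]), zero_add]

/-- Only the crossing of the correct threshold is needed: a wrong crossing can only stop the test
sooner. -/
lemma stopTime_le (f : Fin 2 → Fin L → ℝ → ℝ) (γ : Fin 2 → Fin L → ℝ) (a : ℝ) (b : Fin 2 → ℝ)
    (g : ℝ → ℝ) (μ : Fin 2 → ℝ) (X : ℕ → Fin L → Ω → ℝ) (Z : ℕ → Ω → ℝ) (i : Fin 2) {k : ℕ} {ω : Ω}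
    (h : a ≤ ∑ j ∈ Finset.range k, sgn i * fusionLLR g μ (received f γ b X Z j ω)) :
    ((stopTime f γ (fun _ => a) b g μ X Z ω : ℕ∞) : ℝ≥0∞) ≤ k := by
  have h1 : stopTime f γ (fun _ => a) b g μ X Z ω ≤ (k : ℕ∞) := by
    refine iInf₂_le (f := fun (k : ℕ) (_ : a ≤ fusionStat f γ b g μ X Z k ω ∨
      fusionStat f γ b g μ X Z k ω ≤ -a) => (k : ℕ∞)) k ?_
    rw [← Finset.mul_sum] at h
    change a ≤ sgn i * fusionStat f γ b g μ X Z k ω at h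
    fin_cases i
    · simp [sgn] at h
      exact Or.inr (by linarith)
    · simp [sgn] at h
      exact Or.inl h
  exact (ENat.toENNReal_le.2 h1).trans (by simp)

variable [MeasurableSpace Ω]

lemma measurable_transmit (b : Fin 2 → ℝ) (γ₀ γ₁ : ℝ) : Measurable (transmit b γ₀ γ₁) :=
  (Measurable.ite measurableSet_Ici measurable_const measurable_const).add
    (Measurable.ite measurableSet_Iic measurable_const measurable_const)

lemma measurable_stopTime {f : Fin 2 → Fin L → ℝ → ℝ} (hf : ∀ i l, Measurable (f i l))
    (γ : Fin 2 → Fin L → ℝ) (β b : Fin 2 → ℝ) {g : ℝ → ℝ} (hg : Measurable g) (μ : Fin 2 → ℝ)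
    {X : ℕ → Fin L → Ω → ℝ} {Z : ℕ → Ω → ℝ} (hX : ∀ k l, Measurable (X k l))
    (hZ : ∀ k, Measurable (Z k)) :
    Measurable fun ω => ((stopTime f γ β b g μ X Z ω : ℕ∞) : ℝ≥0∞) := by
  have hloc : ∀ k l, Measurable (localStat f X k l) := fun k l =>
    Finset.measurable_sum _ fun j _ => (measurable_localLLR fun i => hf i l).comp (hX j l)
  have hrec : ∀ k, Measurable (received f γ b X Z k) := fun k =>
    (Finset.measurable_sum _ fun l _ => (measurable_transmit b _ _).comp (hloc _ l)).add (hZ k)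
  have hfus : ∀ k, Measurable (fusionStat f γ b g μ X Z k) := fun k =>
    Finset.measurable_sum _ fun j _ => (measurable_fusionLLR hg μ).comp (hrec j)
  simp only [stopTime, ENat.toENNReal_iInf]
  refine Measurable.iInf fun k => ?_
  have hs : MeasurableSet {ω | β 1 ≤ fusionStat f γ b g μ X Z k ω ∨
      fusionStat f γ b g μ X Z k ω ≤ -β 0} :=
    (measurableSet_le measurable_const (hfus k)).union
      (measurableSet_le (hfus k) measurable_const)
  classical
  have : (fun ω => ⨅ _ : β 1 ≤ fusionStat f γ b g μ X Z k ω ∨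
      fusionStat f γ b g μ X Z k ω ≤ -β 0, (((k : ℕ∞) : ℝ≥0∞))) = fun ω =>
      if β 1 ≤ fusionStat f γ b g μ X Z k ω ∨ fusionStat f γ b g μ X Z k ω ≤ -β 0
        then ((k : ℕ∞) : ℝ≥0∞) else ⊤ := by
    funext ω
    rw [iInf_eq_if]
  rw [this]
  exact Measurable.ite hs measurable_const measurable_const

end Concrete

end DualSPRT

/-! ### DualSPRT as an instance of the abstract crossing time -/

theorem theorem1 {Ω : Type*} [MeasurableSpace Ω]
    -- the probability measures under `H_0` and `H_1`
    (P : Fin 2 → Measure Ω) [∀ i, IsProbabilityMeasure (P i)]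
    -- the local nodes: reference measures and densities of the observations
    (L : ℕ) (hL : 1 ≤ L)
    (ν : Fin L → Measure ℝ) [∀ l, SigmaFinite (ν l)]
    (f : Fin 2 → Fin L → ℝ → ℝ)
    (hf : ∀ i l, Measurable (f i l)) (hf0 : ∀ i l x, 0 ≤ f i l x)
    -- the divergences are finite and the two hypotheses differ at every node
    (hfin : ∀ i l, DualSPRT.kl ν f i l ≠ ⊤)
    (hne : ∀ l, DualSPRT.law (ν l) (f 0 l) ≠ DualSPRT.law (ν l) (f 1 l))
    -- the density of the fusion-centre noise
    (g : ℝ → ℝ) (hg : Measurable g) (hg0 : ∀ x, 0 ≤ g x)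
    -- the parameters of the test
    (b μ : Fin 2 → ℝ) (hμ : ∀ i, 0 < μ i)
    -- the observations and the noise: i.i.d. in time, and all independent
    (X : ℕ → Fin L → Ω → ℝ) (Z : ℕ → Ω → ℝ)
    (hX : ∀ k l, Measurable (X k l)) (hZ : ∀ k, Measurable (Z k))
    (hXlaw : ∀ i k l, (P i).map (X k l) = DualSPRT.law (ν l) (f i l))
    (hZlaw : ∀ i k, (P i).map (Z k) = DualSPRT.law volume g)
    (hindep : ∀ i, iIndepFun (Sum.elim (fun p : ℕ × Fin L => X p.1 p.2) Z) (P i))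
    -- the fusion increments have a mean for every pattern of transmissions, and it is worst
    -- (largest under `H_0`, smallest under `H_1`) when all nodes transmit the wrong decision
    (hint : ∀ i, ∀ y : Fin L → ℝ, (∀ l, y l = 0 ∨ y l = b 0 ∨ y l = b 1) →
      Integrable (fun ω => DualSPRT.fusionLLR g μ (∑ l, y l + Z 0 ω)) (P i))
    (hworst0 : ∀ y : Fin L → ℝ, (∀ l, y l = 0 ∨ y l = b 0 ∨ y l = b 1) →
      ∫ ω, DualSPRT.fusionLLR g μ (∑ l, y l + Z 0 ω) ∂(P 0) ≤ DualSPRT.theta L P b g μ Z 0)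
    (hworst1 : ∀ y : Fin L → ℝ, (∀ l, y l = 0 ∨ y l = b 0 ∨ y l = b 1) →
      DualSPRT.theta L P b g μ Z 1 ≤ ∫ ω, DualSPRT.fusionLLR g μ (∑ l, y l + Z 0 ω) ∂(P 1))
    (hθ0 : 0 < DualSPRT.theta L P b g μ Z 0)
    (hθ1 : DualSPRT.theta L P b g μ Z 1 < 0)
    -- the moment conditions
    (α : ℝ) (hα : 1 < α)
    (hξ : ∀ i, Integrable (fun ω => |DualSPRT.worstIncr L b g μ Z i ω| ^ (α + 1)) (P i))
    (hllr : ∀ i l,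
      Integrable (fun ω => |DualSPRT.localLLR (fun j => f j l) (X 0 l ω)| ^ (α + 1)) (P i)) :
    ∀ i : Fin 2,
      -- almost surely
      (∀ᵐ ω ∂(P i),
        limsup (fun c : ℝ =>
            ((DualSPRT.N ν f b g μ X Z c ω : ℕ∞) : ℝ≥0∞) / ENNReal.ofReal |Real.log c|) (𝓝[>] 0)
          ≤ ENNReal.ofReal (1 / DualSPRT.Dtot ν f i + DualSPRT.M P ν f b g μ Z i)) ∧
      -- in `L¹`: the excess over the bound tends to zero in `L¹`
      Tendsto (fun c : ℝ => ∫⁻ ω,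
          (((DualSPRT.N ν f b g μ X Z c ω : ℕ∞) : ℝ≥0∞) / ENNReal.ofReal |Real.log c|
            - ENNReal.ofReal (1 / DualSPRT.Dtot ν f i + DualSPRT.M P ν f b g μ Z i)) ∂(P i))
        (𝓝[>] 0) (𝓝 0) ∧
      -- in particular for the expected delay
      limsup (fun c : ℝ =>
          (∫⁻ ω, ((DualSPRT.N ν f b g μ X Z c ω : ℕ∞) : ℝ≥0∞) ∂(P i))
            / ENNReal.ofReal |Real.log c|) (𝓝[>] 0)
        ≤ ENNReal.ofReal (1 / DualSPRT.Dtot ν f i + DualSPRT.M P ν f b g μ Z i) := by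
  intro i
  refine DualSPRT.limsup_comp_abs_log (T := fun a ω => ((DualSPRT.stopTime f (fun i l => DualSPRT.share ν f i l * a)
    (fun _ => a) b g μ X Z ω : ℕ∞) : ℝ≥0∞))
    (fun a => DualSPRT.measurable_stopTime hf _ _ b hg μ hX hZ) ?_
  -- the divergences
  have hprob : ∀ i l, IsProbabilityMeasure (DualSPRT.law (ν l) (f i l)) := fun i l => by
    rw [← hXlaw i 0 l]
    exact Measure.isProbabilityMeasure_map (hX 0 l).aemeasurable
  have hkl : ∀ i l, 0 < (DualSPRT.kl ν f i l).toReal := fun i l => by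
    refine ENNReal.toReal_pos (fun h => ?_) (hfin i l)
    rw [DualSPRT.kl, InformationTheory.klDiv_eq_zero_iff] at h
    fin_cases i
    · exact hne l h
    · exact hne l h.symm
  have : Nonempty (Fin L) := ⟨⟨0, hL⟩⟩
  have hD : ∀ i, 0 < DualSPRT.Dtot ν f i := fun i =>
    Finset.sum_pos (fun l _ => hkl i l) Finset.univ_nonempty
  have hshare : ∀ i l, 0 < DualSPRT.share ν f i l := fun i l => div_pos (hkl i l) (hD i)
  have hllrm : ∀ l, Measurable (DualSPRT.localLLR fun j => f j l) :=
    fun l => DualSPRT.measurable_localLLR fun j => hf j l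
  have hφm := DualSPRT.measurable_fusionLLR hg μ
  have hlog : ∀ l, Measurable fun x => Real.log (f i l x / f (1 - i) l x) :=
    fun l => ((hf i l).div (hf (1 - i) l)).log
  have hmean : ∀ l, ∫ ω, DualSPRT.sgn i * DualSPRT.localLLR (fun j => f j l) (X 0 l ω) ∂(P i)
      = (DualSPRT.kl ν f i l).toReal := fun l => by
    rw [DualSPRT.kl, ← DualSPRT.integral_log_div_eq_klDiv (hf i l) (hf (1 - i) l) (hf0 i l)
      (hf0 (1 - i) l) (hfin i l), ← hXlaw i 0 l, integral_map (hX 0 l).aemeasurable (hlog l).aestronglyMeasurable]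
    simp_rw [DualSPRT.sgn_mul_localLLR]
  -- the noise
  have hZid : ∀ k, IdentDistrib (Z k) (Z 0) (P i) (P i) := fun k =>
    ⟨(hZ k).aemeasurable, (hZ 0).aemeasurable, by rw [hZlaw, hZlaw]⟩
  have hZcross : IdentDistrib (Z 0) (Z 0) (P i) (P (1 - i)) :=
    ⟨(hZ 0).aemeasurable, (hZ 0).aemeasurable, by rw [hZlaw, hZlaw]⟩
  have hFm : ∀ p, Measurable (Sum.elim (fun p : ℕ × Fin L => X p.1 p.2) Z p) := by
    rintro (p | k)
    · exact hX p.1 p.2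
    · exact hZ k
  have hZind : iIndepFun Z (P i) := (hindep i).precomp (g := Sum.inr) Sum.inr_injective
  have hincm : ∀ y, Measurable fun z => DualSPRT.sgn i * DualSPRT.fusionLLR g μ (y + z) :=
    fun y => (hφm.comp (measurable_const.add measurable_id)).const_mul _
  -- The correct decision under `H_i` is the wrong one under `H_{1-i}`, and the noise has the same
  -- law under both. So `Δ(𝒜^i) = θ_{1-i}`, whose sign is known.
  have hcorrect : ∫ ω, DualSPRT.fusionLLR g μ (L * b i + Z 0 ω) ∂(P i)
      = DualSPRT.theta L P b g μ Z (1 - i) := by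
    have := (hZcross.comp (u := fun z => DualSPRT.fusionLLR g μ (L * b i + z))
      (hφm.comp (measurable_const.add measurable_id))).integral_eq
    simp only [DualSPRT.theta, DualSPRT.worstIncr, sub_sub_cancel]
    exact this
  have hΔ : 0 < DualSPRT.sgn i * DualSPRT.Delta L P b g μ Z i := by
    rw [DualSPRT.Delta, hcorrect]
    fin_cases i
    · simpa [DualSPRT.sgn] using hθ1
    · simpa [DualSPRT.sgn] using hθ0
  set q := ∫ ω, |DualSPRT.worstIncr L b g μ Z i ω| ∂(P i) with hq
  have hθq : |DualSPRT.theta L P b g μ Z i| ≤ q := abs_integral_le_integral_abs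
  -- Silence of all nodes is an admissible pattern, so its mean is no worse than `θ_i`, and `|θ_i| ≤
  -- q`.
  have hsilent : -q ≤ ∫ ω, DualSPRT.sgn i * DualSPRT.fusionLLR g μ (0 + Z 0 ω) ∂(P i) := by
    have h0 := hworst0 (fun _ => 0) (fun _ => Or.inl rfl)
    have h1 := hworst1 (fun _ => 0) (fun _ => Or.inl rfl)
    rw [Finset.sum_const_zero] at h0 h1
    rw [integral_const_mul]
    have hq1 := (abs_le.1 hθq).1
    have hq2 := (abs_le.1 hθq).2
    clear_value q
    fin_cases i
    · simp [DualSPRT.sgn] at h0 hq1 hq2 ⊢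
      linarith
    · simp [DualSPRT.sgn] at h1 hq1 hq2 ⊢
      linarith
  -- The sign in `C_i` is its own inverse and moves into the denominator.
  have hβ : 1 / DualSPRT.Dtot ν f i + DualSPRT.M P ν f b g μ Z i
      = 1 / DualSPRT.Dtot ν f i + (1 + q / DualSPRT.Dtot ν f i)
        / (DualSPRT.sgn i * DualSPRT.Delta L P b g μ Z i) := by
    have h : (if i = 0 then (-1 : ℝ) else 1) = DualSPRT.sgn i := rfl
    rw [DualSPRT.M, DualSPRT.C, h]
    have h0 : DualSPRT.sgn i ≠ 0 := fun h => by simp [h] at hΔ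
    have hΔ0 : DualSPRT.Delta L P b g μ Z i ≠ 0 := fun h => by simp [h] at hΔ
    congr 1
    rw [div_eq_div_iff hΔ0 (mul_ne_zero h0 hΔ0)]
    linear_combination (1 + q / DualSPRT.Dtot ν f i) * DualSPRT.Delta L P b g μ Z i
      * DualSPRT.sgn_mul_self i
  rw [hβ]
  have hsum : ∀ a j ω, ∑ i_1 ∈ Finset.range (j + 1), DualSPRT.sgn i *
      DualSPRT.localLLR (fun m => f m a) (X i_1 a ω)
      = DualSPRT.sgn i * DualSPRT.localStat f X (j + 1) a ω := fun a j ω => by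
    rw [DualSPRT.localStat, Finset.mul_sum]
  -- The same exchange of hypotheses transfers the moment condition on `ξ*` under `H_{1-i}` to the
  -- correct increment under `H_i`.
  have hB2 : MemLp (fun ω => DualSPRT.sgn i * DualSPRT.fusionLLR g μ (L * b i + Z 0 ω)) 2
      (P i) := by
    have h := DualSPRT.memLp_two_of_integrable_rpow
      (((hφm.comp (measurable_const.add measurable_id)).comp (hZ 0) : Measurable
        (DualSPRT.worstIncr L b g μ Z (1 - i)))) hα (hξ (1 - i))
    simp only [sub_sub_cancel] at h
    have hid := hZcross.comp (u := fun z => DualSPRT.fusionLLR g μ (L * b i + z))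
      (hφm.comp (measurable_const.add measurable_id))
    exact (hid.memLp_iff.2 h).const_mul _
  have hwm : ∀ l, Measurable fun x => DualSPRT.sgn i * DualSPRT.localLLR (fun j => f j l) x :=
    fun l => (hllrm l).const_mul _
  have hψm : Measurable fun (x : ℕ × Fin L → ℝ) (p : ℕ × Fin L) =>
      DualSPRT.sgn i * DualSPRT.localLLR (fun j => f j p.2) (x p) :=
    measurable_pi_lambda _ fun p => (hwm p.2).comp (measurable_pi_apply p)
  have hVm := DualSPRT.measurable_incrBound (L := L) b hg μ
  have hVm' : Measurable fun z : Unit → ℝ => DualSPRT.incrBound L b g μ (z ()) :=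
    hVm.comp (measurable_pi_apply ())
  have hVw : ∀ j, IndepFun (fun ω => DualSPRT.incrBound L b g μ (Z j ω))
      (fun ω (p : ℕ × Fin L) =>
        DualSPRT.sgn i * DualSPRT.localLLR (fun j => f j p.2) (X p.1 p.2 ω)) (P i) := fun j => by
    have h := DualSPRT.indepFun_subfamily (hindep i) hFm (fun _ : Unit => Sum.inr j)
      (fun p : ℕ × Fin L => Sum.inl p) (by simp)
    exact h.comp hVm' hψm
  -- `A` is the increment when all nodes are silent, `B` when all are correct. The correct threshold
  -- `share i l * a` is `d l / D * a` by definition, and `r` gives the wrong-side thresholds.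
  refine DualSPRT.asymptotic_crossing_time
    (w := fun l k ω => DualSPRT.sgn i * DualSPRT.localLLR (fun j => f j l) (X k l ω))
    (d := fun l => (DualSPRT.kl ν f i l).toReal) (r := DualSPRT.share ν f (1 - i))
    (A := fun j ω => DualSPRT.sgn i * DualSPRT.fusionLLR g μ (0 + Z j ω))
    (B := fun j ω => DualSPRT.sgn i * DualSPRT.fusionLLR g μ (L * b i + Z j ω))
    (V := fun j ω => DualSPRT.incrBound L b g μ (Z j ω))
    (I := fun a j ω => DualSPRT.sgn i * DualSPRT.fusionLLR g μ
      (DualSPRT.received f (fun i l => DualSPRT.share ν f i l * a) b X Z j ω))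
    (hkl i) (hshare (1 - i)) (hD i) (fun l k => (hwm l).comp (hX k l)) ?_ ?_ ?_ hmean
    (hZind.comp _ fun _ => hincm 0) (fun k => (hZid k).comp (hincm 0)) ?_ hsilent
    (integral_nonneg fun ω => abs_nonneg _) (fun k => (hincm _).comp (hZ k))
    (hZind.comp _ fun _ => hincm _) (fun k => (hZid k).comp (hincm _)) hB2 ?_ hΔ
    (fun k => hVm.comp (hZ k))
    (hZind.comp _ fun _ => hVm)
    (fun k => (hZid k).comp hVm) ?_ hVw ?_ ?_ ?_ ?_
    (fun a => DualSPRT.measurable_stopTime hf _ _ b hg μ hX hZ)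
    (fun a _ ω k h => DualSPRT.stopTime_le f _ a b g μ X Z i h)
  · intro l
    have h : iIndepFun (fun k => X k l) (P i) := (hindep i).precomp
      (g := fun k : ℕ => Sum.inl (k, l)) (fun a c h => by simpa using h)
    exact h.comp _ fun _ => hwm l
  · intro l k
    have h : IdentDistrib (X k l) (X 0 l) (P i) (P i) :=
      ⟨(hX k l).aemeasurable, (hX 0 l).aemeasurable, by rw [hXlaw, hXlaw]⟩
    exact h.comp (hwm l)
  · intro l
    exact (DualSPRT.memLp_two_of_integrable_rpow ((hllrm l).comp (hX 0 l)) hα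
      (hllr i l)).const_mul _
  · have h := hint i (fun _ => 0) (fun _ => Or.inl rfl)
    rw [Finset.sum_const_zero] at h
    exact h.const_mul _
  · rw [integral_const_mul]
    rfl
  · refine integrable_finsetSum _ fun p _ => (hint i _ fun l => ?_).abs
    generalize p l = s
    fin_cases s <;> simp [DualSPRT.signal]
  · intro j ω
    rw [abs_mul, DualSPRT.abs_sgn, one_mul]
    have h := DualSPRT.abs_fusionLLR_le_incrBound b g μ (Z j ω) (y := fun _ : Fin L => b i)
      (fun _ => by fin_cases i <;> simp)
    rwa [Finset.sum_const, Finset.card_univ, Fintype.card_fin, nsmul_eq_mul] at h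
  · intro a ha j ω
    rw [abs_mul, DualSPRT.abs_sgn, one_mul]
    exact DualSPRT.abs_fusionLLR_le_incrBound b g μ (Z j ω) fun l =>
      DualSPRT.transmit_mem (mul_pos (hshare 0 l) ha) (mul_pos (hshare 1 l) ha) _
  · intro a ha j ω h
    have h' : ∀ l, DualSPRT.transmit b (DualSPRT.share ν f 0 l * a) (DualSPRT.share ν f 1 l * a)
        (DualSPRT.localStat f X (j + 1) l ω) = b i := fun l =>
      DualSPRT.transmit_correct (γ := fun i => DualSPRT.share ν f i l * a)
        (fun i => mul_pos (hshare i l) ha) i (by rw [← hsum]; exact h l)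
    simp only [DualSPRT.received, h', Finset.sum_const, Finset.card_univ, Fintype.card_fin,
      nsmul_eq_mul]
  · intro a ha j ω h
    have h' : ∀ l, DualSPRT.transmit b (DualSPRT.share ν f 0 l * a) (DualSPRT.share ν f 1 l * a)
        (DualSPRT.localStat f X (j + 1) l ω) = 0 := fun l =>
      DualSPRT.transmit_silent (γ := fun i => DualSPRT.share ν f i l * a) i
        (by rw [← hsum]; exact h l)
    simp only [DualSPRT.received, h', Finset.sum_const_zero]
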